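/- Let $p\in[0,1]$. Let $(X_k^v)_{k,v\in\mathbb Z}$ be i.i.d. with $\mathbf P[X_k^v=1]=\mathbf P[X_k^v=-1]=1/2$, and let $(\bar\xi_k^v)_{k,v\in\mathbb Z}$, $(\hat\xi_k^v)_{k,v\in\mathbb Z}$ be i.i.d. $\pm1$-valued with $\mathbf P[\bar\xi_k^v=-1]=\mathbf P[\hat\xi_k^v=-1]=p$, independent of $(X_k^v)$. Put $$\bar Y_k^v = X_k^vX_{k-1}^v\bar\xi_k^v,\qquad \hat Y_k^v = X_k^vX_k^{v+1}\hat\xi_k^v,$$ $X_k=(X_k^v)_{v\in\mathbb Z}$ and $Y_k=(\bar Y_k^v,\hat Y_k^v)_{v\in\mathbb Z}$. The filter is called stable if $$\mathbf E\bigl|\mathbf P[X_k\in A\mid X_0,Y_1,\ldots,Y_k]-\mathbf P[X_k\in A\mid Y_1,\ldots,Y_k]\bigr|\to0\quad\text{as }k\to\infty$$ for every measurable $A\subseteq\{-1,1\}^{\mathbb Z}$. Then there exist constants $0<p_\star\le p^\star<1/2$ such that the filter is stable for $p^\star<p\le 1/2$ and is not stable for $0\le p<p_\star$. Moreover, for every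 $p\in[0,1]$ the random field $(X_k^v,Y_k^v)_{k,v\in\mathbb Z}$, where $Y_k^v=(\bar Y_k^v,\hat Y_k^v)$, is one-dependent: its restrictions to any two sets $A,B\subseteq\mathbb Z^2$ with $\|q-r\|_\infty>1$ for all $q\in A$, $r\in B$ are independent. -/

import Mathlib

open MeasureTheory ProbabilityTheory Filter Topology

noncomputable section

/-- The sigma-algebra generated by the observations `Y_1, …, Y_k`. -/
abbrev obsSigma {Ω T : Type*} [MeasurableSpace T] (Y : ℤ → Ω → T) (k : ℕ) : MeasurableSpace Ω :=
  ⨆ j ∈ Set.Icc (1 : ℤ) k, MeasurableSpace.comap (Y j) inferInstance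

/-- The sigma-algebra generated by the initial state `X_0` and the observations `Y_1, …, Y_k`. -/
abbrev initObsSigma {Ω S T : Type*} [MeasurableSpace S] [MeasurableSpace T]
    (X : ℤ → Ω → S) (Y : ℤ → Ω → T) (k : ℕ) : MeasurableSpace Ω :=
  MeasurableSpace.comap (X 0) inferInstance ⊔ obsSigma Y k

/-- Filter stability: for every measurable set `A` of states,
`P[X_k ∈ A | X_0, Y_1, …, Y_k] - P[X_k ∈ A | Y_1, …, Y_k]` tends to `0` in `L¹` as `k → ∞`.
The processes are measurable, indexed by integer times. -/
def FilterStable {Ω S T : Type*} [MeasurableSpace Ω] [MeasurableSpace S] [MeasurableSpace T]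
    (P : Measure Ω) (X : ℤ → Ω → S) (Y : ℤ → Ω → T) : Prop :=
  ∀ A : Set S, MeasurableSet A →
    Tendsto (fun k : ℕ =>
      ∫ ω, |(P⟦X k ⁻¹' A | initObsSigma X Y k⟧) ω - (P⟦X k ⁻¹' A | obsSigma Y k⟧) ω| ∂P)
      atTop (𝓝 0)

/-- A random field `Z` on `ℤ²` is one-dependent if its restrictions to any two sets of sites
at sup-norm distance greater than one are independent. -/
def OneDependent {Ω E : Type*} [MeasurableSpace Ω] [MeasurableSpace E]
    (P : Measure Ω) (Z : ℤ × ℤ → Ω → E) : Prop :=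
  ∀ A B : Set (ℤ × ℤ),
    (∀ q ∈ A, ∀ r ∈ B, 1 < max |q.1 - r.1| |q.2 - r.2|) →
    IndepFun (fun ω (q : A) => Z q ω) (fun ω (r : B) => Z r ω) P

namespace SpinModel

/-- The sample space: a triple of sign configurations `(x, ξ̄, ξ̂)` on space-time `ℤ × ℤ`;
a point `(k, v)` has time coordinate `k` and space coordinate `v`. Signs `±1` are the
units of `ℤ`. -/
abbrev Sample : Type := (ℤ × ℤ → ℤˣ) × (ℤ × ℤ → ℤˣ) × (ℤ × ℤ → ℤˣ)

/-- The law of i.i.d. signs on space-time, each equal to `-1` with probability `p` and to `1`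
with probability `1 - p`. -/
def iidSigns (p : unitInterval) : Measure (ℤ × ℤ → ℤˣ) :=
  Measure.infinitePi fun _ => bernoulliMeasure (-1) 1 p

/-- The probability `1 / 2`. -/
def half : unitInterval := ⟨1 / 2, Set.mem_Icc.2 ⟨by norm_num, by norm_num⟩⟩

/-- The law of the model: the spins are i.i.d. symmetric signs, and the two noise fields are
i.i.d. signs that are `-1` with probability `p`, all of them independent. -/
def law (p : unitInterval) : Measure Sample :=
  (iidSigns half).prod ((iidSigns p).prod (iidSigns p))

/-- The spin `X_k^v`. -/
def spin (k v : ℤ) (ω : Sample) : ℤˣ := ω.1 (k, v)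

/-- The noise `ξ̄_k^v` of the observation in the time direction. -/
def noiseT (k v : ℤ) (ω : Sample) : ℤˣ := ω.2.1 (k, v)

/-- The noise `ξ̂_k^v` of the observation in the space direction. -/
def noiseS (k v : ℤ) (ω : Sample) : ℤˣ := ω.2.2 (k, v)

/-- The pair of local observations
`(X_k^v X_{k-1}^v ξ̄_k^v, X_k^v X_k^{v+1} ξ̂_k^v)`. -/
def localObs (k v : ℤ) (ω : Sample) : ℤˣ × ℤˣ :=
  (spin k v ω * spin (k - 1) v ω * noiseT k v ω,
   spin k v ω * spin k (v + 1) ω * noiseS k v ω)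

/-- The state `X_k = (X_k^v)_v` at time `k`. -/
def X (k : ℤ) (ω : Sample) : ℤ → ℤˣ := fun v => spin k v ω

/-- The observation `Y_k = (Ȳ_k^v, Ŷ_k^v)_v` at time `k`. -/
def Y (k : ℤ) (ω : Sample) : ℤ → ℤˣ × ℤˣ := fun v => localObs k v ω

/-- The space-time random field `(X_k^v, Y_k^v)`. -/
def field (q : ℤ × ℤ) (ω : Sample) : ℤˣ × (ℤˣ × ℤˣ) :=
  (spin q.1 q.2 ω, localObs q.1 q.2 ω)

end SpinModel

end

/-! Instability for small `p` is a Peierls argument. Every observation contains a product of two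
spins, so the global spin flip fixes `Y` and the conditional probability of `X_n^0 = 1` given `Y`
alone is `1 / 2`. Knowledge of the initial state breaks this symmetry. If two sample points share
the data in a box but differ at the site `(n, 0)`, their relative sign field is `1` at time `0` and
`-1` at `(n, 0)`, so its interface contains a long self-avoiding walk (`exists_interface_walk`).
Across each interface bond the two noises are opposite, so one of the two points has noise `-1` on
at least half of the walk. There are at most `18 ^ m` walks of length `m` from a given bond, and
each is that noisy with probability at most `(2 * √p) ^ m`; hence for small `p` the data determine
the spin outside an event of probability at most `1 / 4` (`law_real_badEvent_le`,
`spin_eq_of_data_eq`).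

Stability near `1 / 2` is disagreement percolation. In a finite box the posterior is a Gibbs measure
with bond weights `p` and `1 - p`. For two replicas with different initial states, write each pair
weight as its minimum `p ^ 2` plus a nonnegative excess and expand over the set `B` of bonds that
select the excess. If `B` does not connect the observed sites to time `0`, exchanging the replicas
on a separating set of sites cancels its contribution. Otherwise `B` contains a walk of length `n`,
which costs `q ^ n` with `q = 1 - (p / (1 - p)) ^ 2` (`abs_sum_sum_sub_le`). Near `p = 1 / 2` this
beats the number of walks, uniformly in the box; martingale convergence removes the box and density
of cylinders gives all events.

One-dependence holds because the field at a site is a function of a few nearby independent signs. -/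

noncomputable section

namespace SpinModel

/-! ### Bonds and self-avoiding walks -/

/-- Labels of the observed bonds: `(true, k, v)` is the bond in the time direction joining
`(k, v)` to `(k - 1, v)`, and `(false, k, v)` the bond in the space direction joining `(k, v)`
to `(k, v + 1)`. -/
abbrev Edge : Type := Bool × ℤ × ℤ

/-- The bonds whose labels are at sup-distance at most one. -/
def nbr (e : Edge) : Finset Edge :=
  Finset.univ ×ˢ Finset.Icc (e.2.1 - 1) (e.2.1 + 1) ×ˢ Finset.Icc (e.2.2 - 1) (e.2.2 + 1)

lemma mem_nbr {e f : Edge} : f ∈ nbr e ↔ |e.2.1 - f.2.1| ≤ 1 ∧ |e.2.2 - f.2.2| ≤ 1 := by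
  simp only [nbr, Finset.mem_product, Finset.mem_univ, Finset.mem_Icc, true_and, abs_le]
  constructor <;> rintro ⟨⟨_, _⟩, _, _⟩ <;> refine ⟨⟨?_, ?_⟩, ?_, ?_⟩ <;> linarith

lemma card_nbr (e : Edge) : (nbr e).card = 18 := by
  simp only [nbr, Finset.card_product, Int.card_Icc, Finset.card_univ, Fintype.card_bool]
  have h : ∀ a : ℤ, (a + 1 + 1 - (a - 1)).toNat = 3 := fun a => by omega
  rw [h, h]

/-- The lists of `n` bonds starting at `e` in which consecutive bonds are neighbours. -/
def walks : ℕ → Edge → Finset (List Edge)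
  | 0, _ => {[]}
  | n + 1, e => (nbr e).biUnion fun f => (walks n f).image (List.cons e)

lemma card_walks_le (n : ℕ) (e : Edge) : (walks n e).card ≤ 18 ^ n := by
  induction n generalizing e with
  | zero => simp [walks]
  | succ n ih =>
    calc (walks (n + 1) e).card
        ≤ ∑ f ∈ nbr e, ((walks n f).image (List.cons e)).card := Finset.card_biUnion_le
      _ ≤ ∑ _f ∈ nbr e, 18 ^ n :=
          Finset.sum_le_sum fun f _ => Finset.card_image_le.trans (ih f)
      _ = 18 ^ (n + 1) := by rw [Finset.sum_const, card_nbr, smul_eq_mul, pow_succ]; ring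

lemma length_of_mem_walks {n : ℕ} {e : Edge} {l : List Edge} (h : l ∈ walks n e) :
    l.length = n := by
  induction n generalizing e l with
  | zero => simp_all [walks]
  | succ n ih =>
    simp only [walks, Finset.mem_biUnion, Finset.mem_image] at h
    obtain ⟨f, _, l', hl', rfl⟩ := h
    simp [ih hl']

/-- The graph on a set of bonds in which distinct bonds at sup-distance at most one are
adjacent. -/
def bondGraph (B : Set Edge) : SimpleGraph Edge where
  Adj e f := e ≠ f ∧ e ∈ B ∧ f ∈ B ∧ f ∈ nbr e
  symm := ⟨fun e f h => ⟨h.1.symm, h.2.2.1, h.2.1, by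
    have := mem_nbr.1 h.2.2.2
    rw [mem_nbr, abs_sub_comm, abs_sub_comm f.2.2]; exact this⟩⟩
  loopless := ⟨fun _ h => h.1 rfl⟩

lemma take_support_mem_walks {B : Set Edge} {e f : Edge} (p : (bondGraph B).Walk e f)
    {n : ℕ} (hn : n ≤ p.length + 1) : p.support.take n ∈ walks n e := by
  induction p generalizing n with
  | @nil u =>
    rcases n with _ | n
    · simp [walks]
    · obtain rfl : n = 0 := by simpa using hn
      simp only [walks, Finset.mem_biUnion]
      exact ⟨u, mem_nbr.2 (by simp), by simp⟩
  | cons h p ih =>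
    rcases n with _ | n
    · simp [walks]
    · simp only [walks, SimpleGraph.Walk.support_cons, Finset.mem_biUnion, List.take_succ_cons]
      exact ⟨_, h.2.2.2, Finset.mem_image_of_mem _ (ih (by simpa using hn))⟩

lemma abs_sub_le_length {B : Set Edge} {e f : Edge} (p : (bondGraph B).Walk e f) :
    |e.2.1 - f.2.1| ≤ p.length ∧ |e.2.2 - f.2.2| ≤ p.length := by
  induction p with
  | nil => simp
  | @cons u v w h p ih =>
    have h1 := mem_nbr.1 h.2.2.2
    simp only [SimpleGraph.Walk.length_cons, Nat.cast_add, Nat.cast_one]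
    constructor
    · linarith [h1.1, ih.1, abs_sub_le u.2.1 v.2.1 w.2.1]
    · linarith [h1.2, ih.2, abs_sub_le u.2.2 v.2.2 w.2.2]

lemma mem_of_mem_support {B : Set Edge} {e f : Edge} (p : (bondGraph B).Walk e f)
    (he : e ∈ B) {g : Edge} (hg : g ∈ p.support) : g ∈ B := by
  induction p with
  | nil => simp_all
  | cons h p ih =>
    rcases List.mem_cons.1 (by simpa using hg) with rfl | hg
    · exact he
    · exact ih h.2.2.1 hg

/-- Two connected bonds at distance at least `n - 1` are joined by a self-avoiding walk, which
has at least `n` bonds. -/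
lemma exists_nodup_walk {B : Set Edge} {e f : Edge} (he : e ∈ B)
    (h : (bondGraph B).Reachable e f) {n : ℕ}
    (hn : (n : ℤ) ≤ |e.2.1 - f.2.1| + 1 ∨ (n : ℤ) ≤ |e.2.2 - f.2.2| + 1) :
    ∃ l ∈ walks n e, l.Nodup ∧ ∀ g ∈ l, g ∈ B := by
  classical
  obtain ⟨p, hp⟩ := h.exists_isPath
  have hlen := abs_sub_le_length p
  refine ⟨p.support.take n, take_support_mem_walks p ?_,
    hp.support_nodup.sublist (List.take_sublist _ _),
    fun g hg => mem_of_mem_support p he (List.mem_of_mem_take hg)⟩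
  rcases hn with hn | hn <;> · zify; linarith [hlen.1, hlen.2]

/-! ### The model as one family of independent signs -/

instance : DiscreteMeasurableSpace ℤˣ :=
  ⟨fun s => ⟨Units.val '' s, .of_discrete, Set.preimage_image_eq s Units.val_injective⟩⟩

instance (p : unitInterval) : IsProbabilityMeasure (iidSigns p) := by
  unfold iidSigns; infer_instance

instance (p : unitInterval) : IsProbabilityMeasure (law p) := by
  unfold law; infer_instance

/-- Indices of the independent signs of the model: spins, time noise, space noise. -/
abbrev Coord : Type := (ℤ × ℤ) ⊕ ((ℤ × ℤ) ⊕ (ℤ × ℤ))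

/-- The independent signs of the model as a single family. -/
def coord : Coord → Sample → ℤˣ
  | .inl s, ω => ω.1 s
  | .inr (.inl s), ω => ω.2.1 s
  | .inr (.inr s), ω => ω.2.2 s

lemma measurable_coord (i : Coord) : Measurable (coord i) := by
  rcases i with s | s | s <;> unfold coord <;> fun_prop

lemma law_iInter_coord (p : unitInterval) (I : Finset Coord) (t : Coord → Set ℤˣ) :
    law p (⋂ i ∈ I, coord i ⁻¹' t i) =
      (∏ s ∈ I.toLeft, bernoulliMeasure (-1) 1 half (t (.inl s))) *
      ((∏ s ∈ I.toRight.toLeft, bernoulliMeasure (-1) 1 p (t (.inr (.inl s)))) *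
        ∏ s ∈ I.toRight.toRight, bernoulliMeasure (-1) 1 p (t (.inr (.inr s)))) := by
  have : ⋂ i ∈ I, coord i ⁻¹' t i =
      (Set.pi I.toLeft fun s => t (.inl s)) ×ˢ
      (Set.pi I.toRight.toLeft fun s => t (.inr (.inl s))) ×ˢ
        (Set.pi I.toRight.toRight fun s => t (.inr (.inr s))) := by
    ext ω
    simp [coord, Set.mem_pi]
  rw [this, law, Measure.prod_prod, Measure.prod_prod, iidSigns, iidSigns,
    Measure.infinitePi_pi _ fun _ _ => .of_discrete,
    Measure.infinitePi_pi _ fun _ _ => .of_discrete,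
    Measure.infinitePi_pi _ fun _ _ => .of_discrete]

lemma law_coord_preimage (p : unitInterval) (i : Coord) (t : Set ℤˣ) :
    law p (coord i ⁻¹' t) = Sum.elim (fun _ => bernoulliMeasure (-1) 1 half t)
      (fun _ => bernoulliMeasure (-1) 1 p t) i := by
  have hl {α β : Type} (a : α) : ({.inl a} : Finset (α ⊕ β)).toLeft = {a} := by ext; simp
  have hl' {α β : Type} (a : α) : ({.inl a} : Finset (α ⊕ β)).toRight = ∅ := by ext; simp
  have hr {α β : Type} (a : β) : ({.inr a} : Finset (α ⊕ β)).toLeft = ∅ := by ext; simp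
  have hr' {α β : Type} (a : β) : ({.inr a} : Finset (α ⊕ β)).toRight = {a} := by ext; simp
  have he {α β : Type} : (∅ : Finset (α ⊕ β)).toLeft = ∅ := by ext; simp
  have he' {α β : Type} : (∅ : Finset (α ⊕ β)).toRight = ∅ := by ext; simp
  have := law_iInter_coord p {i} fun _ => t
  rcases i with s | s | s <;> simpa [hl, hl', hr, hr', he, he'] using this

lemma iIndepFun_coord (p : unitInterval) : iIndepFun coord (law p) := by
  rw [iIndepFun_iff_measure_inter_preimage_eq_mul]
  intro I t _
  rw [law_iInter_coord, ← Finset.toLeft_disjSum_toRight (u := I), Finset.prod_disjSum]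
  conv_rhs => rw [← Finset.toLeft_disjSum_toRight (u := I.toRight), Finset.prod_disjSum]
  simp [law_coord_preimage]

/-! ### One-dependence -/

/-- The coordinates that determine the field at a site. -/
def dep (q : ℤ × ℤ) : Set Coord :=
  {.inl q, .inl (q.1 - 1, q.2), .inl (q.1, q.2 + 1), .inr (.inl q), .inr (.inr q)}

lemma measurable_mul_mul {Ω : Type*} {m : MeasurableSpace Ω} {f g h : Ω → ℤˣ}
    (hf : Measurable f) (hg : Measurable g) (hh : Measurable h) :
    Measurable fun ω => f ω * g ω * h ω :=
  (Measurable.of_discrete (f := fun z : ℤˣ × ℤˣ × ℤˣ => z.1 * z.2.1 * z.2.2)).comp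
    (hf.prodMk (hg.prodMk hh))

lemma comap_field_le (A : Set (ℤ × ℤ)) :
    MeasurableSpace.comap (fun ω (q : A) => field q ω) inferInstance ≤
      ⨆ i ∈ ⋃ q ∈ A, dep q, MeasurableSpace.comap (coord i) inferInstance := by
  rw [← measurable_iff_comap_le]
  refine @measurable_pi_lambda Sample A (fun _ => _) (_) (fun _ => _) _ ?_
  rintro ⟨q, hq⟩
  set m : MeasurableSpace Sample :=
    ⨆ i ∈ ⋃ q ∈ A, dep q, MeasurableSpace.comap (coord i) inferInstance with hm
  have key (i : Coord) (hi : i ∈ dep q) : Measurable[m] (coord i) := by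
    rw [measurable_iff_comap_le]
    exact le_iSup₂_of_le i (Set.mem_biUnion hq hi) le_rfl
  have h1 := key (.inl q) (by simp [dep])
  have h2 := key (.inl (q.1 - 1, q.2)) (by simp [dep])
  have h3 := key (.inl (q.1, q.2 + 1)) (by simp [dep])
  have h4 := key (.inr (.inl q)) (by simp [dep])
  have h5 := key (.inr (.inr q)) (by simp [dep])
  exact h1.prodMk ((measurable_mul_mul h1 h2 h4).prodMk (measurable_mul_mul h1 h3 h5))

/-- The spins used at a site have offsets `(0, 0)`, `(-1, 0)`, `(0, 1)`, which differ pairwise by at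
most one in sup-norm. Sites farther apart therefore draw on disjoint families of independent signs.
-/
theorem oneDependent_field (p : unitInterval) : OneDependent (law p) field := by
  intro A B hAB
  have hdisj : Disjoint (⋃ q ∈ A, dep q) (⋃ q ∈ B, dep q) := by
    rw [Set.disjoint_left]
    intro i hi hi'
    simp only [Set.mem_iUnion, exists_prop] at hi hi'
    obtain ⟨q, hq, hi⟩ := hi
    obtain ⟨r, hr, hi'⟩ := hi'
    have := hAB q hq r hr
    obtain ⟨q1, q2⟩ := q
    obtain ⟨r1, r2⟩ := r
    simp only [dep, Set.mem_insert_iff, Set.mem_singleton_iff] at hi hi'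
    rw [lt_max_iff, lt_abs, lt_abs] at this
    rcases hi with rfl | rfl | rfl | rfl | rfl <;> simp at hi' <;> omega
  exact indep_of_indep_of_le_left (indep_of_indep_of_le_right
    (indep_iSup_of_disjoint (fun i => (measurable_coord i).comap_le)
      (iIndepFun_coord p) hdisj) (comap_field_le B)) (comap_field_le A)

/-! ### Noise on bonds and finite-dimensional probabilities -/

/-- The noise on a bond. -/
def noise (e : Edge) (ω : Sample) : ℤˣ := if e.1 then ω.2.1 e.2 else ω.2.2 e.2

/-- The endpoint of a bond other than the site that labels it. -/
def tip (e : Edge) : ℤ × ℤ := if e.1 then (e.2.1 - 1, e.2.2) else (e.2.1, e.2.2 + 1)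

/-- The observation on a bond. -/
def obs (e : Edge) (ω : Sample) : ℤˣ := ω.1 e.2 * ω.1 (tip e) * noise e ω

lemma obs_eq (e : Edge) (ω : Sample) :
    obs e ω = if e.1 then (Y e.2.1 ω e.2.2).1 else (Y e.2.1 ω e.2.2).2 := by
  obtain ⟨b, k, v⟩ := e
  cases b <;> rfl

/-- The coordinate of the noise on a bond. -/
def noiseCoord (e : Edge) : Coord := .inr (if e.1 then .inl e.2 else .inr e.2)

lemma noiseCoord_injective : Function.Injective noiseCoord := by
  rintro ⟨_ | _, s⟩ ⟨_ | _, t⟩ h <;> simp_all [noiseCoord]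

lemma coord_noiseCoord (e : Edge) : coord (noiseCoord e) = noise e := by
  obtain ⟨_ | _, s⟩ := e <;> rfl

lemma measurable_noise (e : Edge) : Measurable (noise e) :=
  coord_noiseCoord e ▸ measurable_coord _

/-- The probability that a noise variable takes a given value. -/
def weight (p : ℝ) (z : ℤˣ) : ℝ := if z = -1 then p else 1 - p

lemma bernoulliMeasure_real_singleton (p : unitInterval) (z : ℤˣ) :
    (bernoulliMeasure (-1) 1 p).real {z} = weight p z := by
  classical
  rcases Int.units_eq_one_or z with rfl | rfl <;>
  simp [weight, show (1 : ℤˣ) ≠ -1 by decide,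
    show (-1 : ℤˣ) ≠ 1 by decide]

lemma weight_half (z : ℤˣ) : weight half z = 1 / 2 := by
  unfold weight half; split_ifs <;> norm_num

/-- The probability of prescribed spins and noise at finitely many places. -/
lemma law_real_cylinder (p : unitInterval) (V : Finset (ℤ × ℤ)) (F : Finset Edge)
    (x : ℤ × ℤ → ℤˣ) (z : Edge → ℤˣ) :
    (law p).real {ω | (∀ s ∈ V, ω.1 s = x s) ∧ ∀ e ∈ F, noise e ω = z e} =
      (1 / 2) ^ V.card * ∏ e ∈ F, weight p (z e) := by
  classical
  let zc : Coord → ℤˣ := Sum.elim x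
    (Sum.elim (fun s => z (true, s)) (fun s => z (false, s)))
  have hz (e : Edge) : zc (noiseCoord e) = z e := by obtain ⟨_ | _, s⟩ := e <;> rfl
  have h := (iIndepFun_coord p).measure_inter_preimage_eq_mul
    (V.image .inl ∪ F.image noiseCoord) (sets := fun i => {zc i}) fun _ _ => .of_discrete
  have hset : {ω | (∀ s ∈ V, ω.1 s = x s) ∧ ∀ e ∈ F, noise e ω = z e} =
      ⋂ i ∈ V.image .inl ∪ F.image noiseCoord, coord i ⁻¹' {zc i} := by
    ext ω
    simp only [Set.mem_iInter, Finset.mem_union, Finset.mem_image, Set.mem_preimage,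
      Set.mem_singleton_iff, Set.mem_ofPred_eq]
    constructor
    · rintro ⟨h1, h2⟩ i (⟨s, hs, rfl⟩ | ⟨e, he, rfl⟩)
      · exact h1 s hs
      · rw [coord_noiseCoord, hz]; exact h2 e he
    · intro h
      refine ⟨fun s hs => h _ (.inl ⟨s, hs, rfl⟩), fun e he => ?_⟩
      have := h _ (.inr ⟨e, he, rfl⟩)
      rwa [coord_noiseCoord, hz] at this
  have hdisj : Disjoint (V.image Sum.inl) (F.image noiseCoord) := by
    simp [Finset.disjoint_left, noiseCoord]
  rw [hset, measureReal_def, h, ENNReal.toReal_prod, Finset.prod_union hdisj,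
    Finset.prod_image Sum.inl_injective.injOn, Finset.prod_image noiseCoord_injective.injOn]
  congr 1
  · simp_rw [law_coord_preimage, Sum.elim_inl, ← measureReal_def,
      bernoulliMeasure_real_singleton, weight_half, Finset.prod_const]
  · simp_rw [law_coord_preimage, hz]
    exact Finset.prod_congr rfl fun e _ => bernoulliMeasure_real_singleton p (z e)

/-- The event that at least half of the bonds of `F` have noise `-1`. -/
def halfBad (F : Finset Edge) : Set Sample :=
  {ω | F.card ≤ 2 * (F.filter fun e => noise e ω = -1).card}

/-- Union bound over the at most `2 ^ #F` sets of bonds containing at least half of `F`. Working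
with `s = √p` turns `p ^ #B` into `s ^ (2 * #B) ≤ s ^ #F` without halving a cardinality. -/
lemma law_real_halfBad_le (p : unitInterval) {s : ℝ} (hs0 : 0 ≤ s) (hs1 : s ≤ 1)
    (hsp : s ^ 2 = p) (F : Finset Edge) : (law p).real (halfBad F) ≤ (2 * s) ^ F.card := by
  classical
  have hsub : halfBad F ⊆ ⋃ B ∈ F.powerset.filter (fun B => F.card ≤ 2 * B.card),
      {ω | ∀ e ∈ B, noise e ω = -1} := by
    intro ω hω
    simp only [Set.mem_iUnion]
    exact ⟨F.filter fun e => noise e ω = -1, Finset.mem_filter.2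
      ⟨Finset.mem_powerset.2 (Finset.filter_subset _ _), hω⟩,
      fun e he => (Finset.mem_filter.1 he).2⟩
  have hB (B : Finset Edge) : (law p).real {ω | ∀ e ∈ B, noise e ω = -1} = s ^ (2 * B.card) := by
    have := law_real_cylinder p ∅ B 1 (fun _ => -1)
    simpa [weight, ← hsp, pow_mul] using this
  calc (law p).real (halfBad F)
      ≤ ∑ B ∈ F.powerset.filter (fun B => F.card ≤ 2 * B.card),
          (law p).real {ω | ∀ e ∈ B, noise e ω = -1} :=
        (measureReal_mono hsub (measure_ne_top _ _)).trans (measureReal_biUnion_finset_le _ _)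
    _ ≤ ∑ B ∈ F.powerset.filter (fun B => F.card ≤ 2 * B.card), s ^ F.card :=
        Finset.sum_le_sum fun B hB' => by
          rw [hB]; exact pow_le_pow_of_le_one hs0 hs1 (Finset.mem_filter.1 hB').2
    _ ≤ ∑ B ∈ F.powerset, s ^ F.card :=
        Finset.sum_le_sum_of_subset_of_nonneg (Finset.filter_subset _ _)
          fun _ _ _ => pow_nonneg hs0 _
    _ = (2 * s) ^ F.card := by simp [mul_pow]

/-! ### Interfaces and contours in a box -/

/-- The bonds `(b, k, v)` with `1 ≤ k ≤ n` and `-L ≤ v ≤ L`. -/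
def box (n L : ℕ) : Finset Edge :=
  Finset.univ ×ˢ Finset.Icc (1 : ℤ) n ×ˢ Finset.Icc (-L : ℤ) L

lemma mem_box {n L : ℕ} {e : Edge} :
    e ∈ box n L ↔ (1 ≤ e.2.1 ∧ e.2.1 ≤ n) ∧ (-L ≤ e.2.2 ∧ e.2.2 ≤ (L : ℤ)) := by
  simp [box]

/-- The bonds of `B` across which the sign field `d` changes. -/
def interface (B : Finset Edge) (d : ℤ × ℤ → ℤˣ) : Set Edge :=
  {e | e ∈ B ∧ d e.2 ≠ d (tip e)}

/-- The part of a set of bonds that is connected to the bonds of column `0`. -/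
def attached (F : Set Edge) : Set Edge :=
  {e | e ∈ F ∧ ∃ i : ℤ, (true, i, 0) ∈ F ∧ (bondGraph F).Reachable (true, i, 0) e}

lemma attached_of_nbr {F : Set Edge} {e f : Edge} (he : e ∈ attached F) (hf : f ∈ F)
    (h : f ∈ nbr e) : f ∈ attached F := by
  obtain ⟨heF, i, hi, hr⟩ := he
  refine ⟨hf, i, hi, ?_⟩
  by_cases hef : e = f
  · exact hef ▸ hr
  · exact hr.trans (SimpleGraph.Adj.reachable ⟨hef, heF, hf, h⟩)

open Classical in
/-- The sign `-1` on the bonds of a set and `1` elsewhere. -/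
def signOf (F : Set Edge) (e : Edge) : ℤˣ := if e ∈ F then -1 else 1

lemma units_int_mul_eq (a b : ℤˣ) (h : a ≠ b) : a * b = -1 := by
  revert a b; decide

lemma units_int_mul_self (a : ℤˣ) : a * a = 1 := by
  revert a; decide

/-- Every plaquette contains an even number of bonds of the attached part of an interface. -/
lemma signOf_plaquette {n L : ℕ} {d : ℤ × ℤ → ℤˣ} (h0 : ∀ v : ℕ, v ≤ L → d (0, v) = 1)
    {j v : ℕ} (hj : j < n) (hv : v < L) :
    signOf (attached (interface (box n L) d)) (false, j + 1, v) =
      signOf (attached (interface (box n L) d)) (false, j, v) *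
      (signOf (attached (interface (box n L) d)) (true, j + 1, v) *
        signOf (attached (interface (box n L) d)) (true, j + 1, v + 1)) := by
  set F := interface (box n L) d with hF
  let P : Finset Edge :=
    {(false, (j : ℤ) + 1, (v : ℤ)), (false, (j : ℤ), (v : ℤ)), (true, (j : ℤ) + 1, (v : ℤ)),
      (true, (j : ℤ) + 1, (v : ℤ) + 1)}
  have hP : ∀ e ∈ P, ∀ f ∈ P, f ∈ nbr e := by
    simp [P, mem_nbr]
  -- The bonds of a plaquette are pairwise neighbours, so one attached bond makes every interface
  -- bond among them attached. The sign is then the change of `d`, whose product around the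
  -- plaquette is `1`.
  have hsign (hne : ∃ e ∈ P, e ∈ attached F) :
      ∀ f ∈ P, signOf (attached F) f = d f.2 * d (tip f) := by
    obtain ⟨e, heP, he⟩ := hne
    intro f hf
    by_cases hfF : f ∈ F
    · rw [signOf, if_pos (attached_of_nbr he hfF (hP e heP f hf)), units_int_mul_eq _ _ hfF.2]
    · rw [signOf, if_neg fun h => hfF h.1]
      have : d f.2 = d (tip f) := by
        by_cases hfb : f ∈ box n L
        · by_contra h
          exact hfF ⟨hfb, h⟩
        · simp only [P, Finset.mem_insert, Finset.mem_singleton] at hf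
          rcases hf with rfl | rfl | rfl | rfl <;> simp only [mem_box] at hfb
          · omega
          -- The only plaquette bond that can lie outside the box is the space bond at time `0`, and
          -- `d` is `1` at both of its endpoints.
          · obtain rfl : j = 0 := by omega
            have := h0 (v + 1) hv
            push_cast at this
            simp [tip, h0 v hv.le, this]
          · omega
          · omega
      rw [this, units_int_mul_self]
  by_cases hne : ∃ e ∈ P, e ∈ attached F
  · have h := hsign hne
    rw [h _ (by simp [P]), h _ (by simp [P]), h _ (by simp [P]), h _ (by simp [P])]
    simp only [tip, if_true, Bool.false_eq_true, if_false, add_sub_cancel_right]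
    generalize d (_ + 1, (v : ℤ)) = a
    generalize d (_ + 1, (v : ℤ) + 1) = b
    generalize d (_, (v : ℤ)) = c
    generalize d (_, (v : ℤ) + 1) = e
    revert a b c e; decide
  · push Not at hne
    simp only [signOf]
    rw [if_neg (hne _ (by simp [P])), if_neg (hne _ (by simp [P])), if_neg (hne _ (by simp [P])),
      if_neg (hne _ (by simp [P]))]
    rfl

/-- If `d` is `1` at the sites `(0, v)`, `0 ≤ v ≤ n`, and `-1` at the site `(n, 0)`, then
its interface contains a self-avoiding walk that starts on column `0` and is longer than the
distance of its starting point from the top row. -/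
lemma exists_interface_walk {n : ℕ} {d : ℤ × ℤ → ℤˣ} (h0 : ∀ v : ℕ, v ≤ n → d (0, v) = 1)
    (hd : d (n, 0) = -1) :
    ∃ i < n, ∃ l ∈ walks (i + 1) (true, (n : ℤ) - i, 0), l.Nodup ∧
      ∀ e ∈ l, e ∈ interface (box n n) d := by
  by_contra! hcon
  set F := interface (box n n) d with hF
  -- A path from `(true, i, 0)` to row `n` or column `n` has at least `n - i + 1` bonds; the index
  -- `n - i` is below `n` because bonds of the box have `i ≥ 1`.
  have far (e : Edge) (he : e.2.1 = n ∨ e.2.2 = n) : e ∉ attached F := by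
    rintro ⟨-, i, hi, hr⟩
    have hib : 1 ≤ i ∧ i ≤ n := (mem_box.1 hi.1).1
    obtain ⟨l, hl, hl1, hl2⟩ := exists_nodup_walk (n := (n - i).toNat + 1) hi hr (by
      push_cast
      rw [Int.toNat_of_nonneg (by linarith [hib.2])]
      rcases he with he | he <;> rw [he]
      · left; linarith [neg_abs_le (i - n)]
      · right; simp; linarith [hib.1])
    obtain ⟨e, he, heF⟩ := hcon (n - i).toNat (by omega) l (by
      rw [Int.toNat_of_nonneg (by linarith [hib.2])]
      simpa using hl) hl1
    exact heF (hl2 e he)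
  -- `D` is the sign field, `1` at time `0`, whose interface on the square is the attached part;
  -- plaquette parity makes it consistent between columns. It equals `d` on column `0`, where all
  -- time bonds of the interface are attached. Since attached bonds miss row `n` and column `n`, it
  -- would be `-1` along row `n` and yet `1` at `(n, n)`.
  let D (j v : ℕ) : ℤˣ := ∏ i ∈ Finset.range j, signOf (attached F) (true, (i : ℤ) + 1, v)
  have hcol (j : ℕ) (hj : j ≤ n) : D j 0 = d (j, 0) := by
    induction j with
    | zero => simpa [D] using (h0 0 (Nat.zero_le n)).symm
    | succ j ih =>
      have hstep : signOf (attached F) (true, (j : ℤ) + 1, 0) = d (j + 1, 0) * d (j, 0) := by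
        by_cases h : (true, (j : ℤ) + 1, (0 : ℤ)) ∈ F
        · rw [signOf, if_pos ⟨h, _, h, SimpleGraph.Reachable.refl _⟩]
          simpa [tip] using (units_int_mul_eq _ _ h.2).symm
        · rw [signOf, if_neg fun h' => h h'.1]
          have hb : (true, (j : ℤ) + 1, (0 : ℤ)) ∈ box n n := by rw [mem_box]; simp; omega
          have : d ((j : ℤ) + 1, 0) = d (j, 0) := by
            by_contra h'
            exact h ⟨hb, by simpa [tip] using h'⟩
          rw [this, units_int_mul_self]
      have : D (j + 1) 0 = D j 0 * signOf (attached F) (true, (j : ℤ) + 1, 0) := by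
        simp [D, Finset.prod_range_succ]
      rw [this, ih (by omega), hstep, mul_comm, mul_assoc, units_int_mul_self, mul_one]
      push_cast; rfl
  have hrow (j : ℕ) (hj : j ≤ n) (v : ℕ) (hv : v < n) :
      D j v * D j (v + 1) = signOf (attached F) (false, j, v) := by
    induction j with
    | zero =>
      rw [signOf, if_neg]
      · simp [D]
      · rintro ⟨h, -⟩
        have := (mem_box.1 h.1).1
        simp at this
    | succ j ih =>
      push_cast
      rw [signOf_plaquette h0 (by omega) hv, ← ih (by omega)]
      simp only [D, Finset.prod_range_succ]
      push_cast
      exact mul_mul_mul_comm _ _ _ _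
  have htop (v : ℕ) (hv : v ≤ n) : D n v = -1 := by
    induction v with
    | zero => rw [hcol n le_rfl, hd]
    | succ v ih =>
      have h := hrow n le_rfl v (by omega)
      rw [ih (by omega), signOf, if_neg (far _ (.inl rfl))] at h
      rw [← inv_eq_of_mul_eq_one_right h]; rfl
  have hlast : D n n = 1 := Finset.prod_eq_one fun i _ => by
    rw [signOf, if_neg (far _ (.inr rfl))]
  rw [htop n le_rfl] at hlast
  exact absurd hlast (by decide)

/-! ### Finite data and the observation sigma-algebras -/

lemma measurable_X (k : ℤ) : Measurable (X k) :=
  measurable_pi_lambda _ fun v => measurable_coord (.inl (k, v))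

lemma measurable_Y (k : ℤ) : Measurable (Y k) :=
  measurable_pi_lambda _ fun v =>
    (measurable_mul_mul (measurable_coord (.inl (k, v))) (measurable_coord (.inl (k - 1, v)))
      (measurable_coord (.inr (.inl (k, v))))).prodMk
    (measurable_mul_mul (measurable_coord (.inl (k, v))) (measurable_coord (.inl (k, v + 1)))
      (measurable_coord (.inr (.inr (k, v)))))

lemma obsSigma_le (n : ℕ) : obsSigma Y n ≤ (inferInstance : MeasurableSpace Sample) :=
  iSup₂_le fun j _ => (measurable_Y j).comap_le

lemma initObsSigma_le (n : ℕ) : initObsSigma X Y n ≤ (inferInstance : MeasurableSpace Sample) :=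
  sup_le (measurable_X 0).comap_le (obsSigma_le n)

/-- The observed part of the initial state in a box. -/
def dataX (L : ℕ) (ω : Sample) : Finset.Icc (-L : ℤ) (L + 1) → ℤˣ := fun v => ω.1 (0, v)

/-- The observations in a box. -/
def dataY (n L : ℕ) (ω : Sample) : box n L → ℤˣ := fun e => obs e ω

lemma measurable_dataX (L : ℕ) :
    Measurable[MeasurableSpace.comap (X 0) inferInstance] (dataX L) := by
  refine @measurable_pi_lambda Sample _ (fun _ => _) (_) (fun _ => _) _ fun v => ?_
  exact (measurable_pi_apply (v : ℤ)).comp (comap_measurable (X 0))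

lemma measurable_obs {n L : ℕ} {e : Edge} (he : e ∈ box n L) :
    Measurable[obsSigma Y n] (obs e) := by
  have h : MeasurableSpace.comap (Y e.2.1) inferInstance ≤ obsSigma Y n :=
    le_iSup₂_of_le (f := fun (j : ℤ) (_ : j ∈ Set.Icc (1 : ℤ) n) =>
      MeasurableSpace.comap (Y j) inferInstance) e.2.1 (mem_box.1 he).1 le_rfl
  have hf : Measurable fun y : ℤ → ℤˣ × ℤˣ => if e.1 then (y e.2.2).1 else (y e.2.2).2 := by
    split_ifs
    · exact measurable_fst.comp (measurable_pi_apply _)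
    · exact measurable_snd.comp (measurable_pi_apply _)
  rw [show obs e = (fun y : ℤ → ℤˣ × ℤˣ => if e.1 then (y e.2.2).1 else (y e.2.2).2) ∘ Y e.2.1
    from funext fun ω => obs_eq e ω]
  exact hf.comp ((comap_measurable (Y e.2.1)).mono h le_rfl)

lemma measurable_dataY (n L : ℕ) : Measurable[obsSigma Y n] (dataY n L) :=
  @measurable_pi_lambda Sample _ (fun _ => _) (_) (fun _ => _) _ fun e => measurable_obs e.2

lemma measurable_data (n L : ℕ) :
    Measurable[initObsSigma X Y n] fun ω => (dataX L ω, dataY n L ω) :=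
  ((measurable_dataX L).mono le_sup_left le_rfl).prodMk
    ((measurable_dataY n L).mono le_sup_right le_rfl)

/-! ### Flip symmetry and instability for small noise -/

/-- The global spin flip. -/
def flip (ω : Sample) : Sample := (fun s => -ω.1 s, ω.2)

lemma map_neg_bernoulliMeasure_half :
    (bernoulliMeasure (-1) 1 half : Measure ℤˣ).map (fun z => -z) = bernoulliMeasure (-1) 1 half := by
  classical
  have hs : unitInterval.toNNReal (unitInterval.symm half) = unitInterval.toNNReal half := by
    congr 1
    ext
    simp [half]
    norm_num
  refine Measure.ext_of_singleton fun z => ?_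
  rw [Measure.map_apply .of_discrete .of_discrete]
  rcases Int.units_eq_one_or z with rfl | rfl <;>
  simp [show (1 : ℤˣ) ≠ -1 by decide,
    show (-1 : ℤˣ) ≠ 1 by decide, hs]

lemma measurePreserving_flip (p : unitInterval) : MeasurePreserving flip (law p) (law p) := by
  have h1 : MeasurePreserving (fun (x : ℤ × ℤ → ℤˣ) s => -x s) (iidSigns half)
      (iidSigns half) := by
    refine ⟨measurable_pi_lambda _ fun s =>
      (Measurable.of_discrete (f := fun z : ℤˣ => -z)).comp (measurable_pi_apply s), ?_⟩
    rw [iidSigns, Measure.infinitePi_map_pi (f := fun _ z => -z) _ fun _ => .of_discrete]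
    simp_rw [map_neg_bernoulliMeasure_half]
  exact h1.prod (MeasurePreserving.id _)

lemma Y_flip (k : ℤ) (ω : Sample) : Y k (flip ω) = Y k ω := by
  funext v
  simp [Y, localObs, spin, flip, noiseT, noiseS]

lemma obsSigma_le_invariants (n : ℕ) : obsSigma Y n ≤ MeasurableSpace.invariants flip := by
  refine iSup₂_le fun j _ => ?_
  rintro _ ⟨t, ht, rfl⟩
  exact ⟨measurable_Y j ht, by ext ω; simp [Y_flip]⟩

/-- An event that a measure preserving map exchanges with its complement has conditional
probability `1 / 2` given invariant events. -/
lemma condExp_eq_half_of_invariants {Ω : Type*} {m m₀ : MeasurableSpace Ω} {P : Measure Ω}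
    [IsProbabilityMeasure P] {φ : Ω → Ω} (hφ : MeasurePreserving φ P P)
    (hm : m ≤ MeasurableSpace.invariants φ) {A : Set Ω} (hA : MeasurableSet A)
    (hAφ : φ ⁻¹' A = Aᶜ) : P⟦A | m⟧ =ᵐ[P] fun _ => 1 / 2 := by
  have hm₀ : m ≤ m₀ := hm.trans (MeasurableSpace.invariants_le φ)
  refine (ae_eq_condExp_of_forall_setIntegral_eq hm₀ ((integrable_const 1).indicator hA)
    (fun _ _ _ => (integrable_const _).integrableOn) (fun s hs _ => ?_)
    aestronglyMeasurable_const).symm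
  have hs₀ : MeasurableSet[m₀] s := hm₀ s hs
  have h1 : P.real (s ∩ A) = P.real (s ∩ Aᶜ) := by
    have := hφ.measureReal_preimage (hs₀.inter hA).nullMeasurableSet
    rw [Set.preimage_inter, (hm s hs).2, hAφ] at this
    exact this.symm
  have h2 : P.real (s ∩ A) + P.real (s ∩ Aᶜ) = P.real s := measureReal_inter_add_sdiff hA
  rw [setIntegral_indicator hA, setIntegral_const, setIntegral_const, smul_eq_mul, smul_eq_mul]
  linarith

/-- If `A` is approximated by an `m`-measurable event `T`, then the conditional probability of
`A` given `m` is far from `1 / 2`. -/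
lemma half_sub_le_integral_abs_condExp_sub {Ω : Type*} {m m₀ : MeasurableSpace Ω}
    {P : Measure Ω} [IsProbabilityMeasure P] (hm : m ≤ m₀) {A T : Set Ω} (hA : MeasurableSet A)
    (hT : MeasurableSet[m] T) :
    1 / 2 - P.real (symmDiff A T) ≤ ∫ ω, |(P⟦A | m⟧) ω - 1 / 2| ∂P := by
  have hT₀ : MeasurableSet[m₀] T := hm T hT
  have hint : Integrable (fun ω => (P⟦A | m⟧) ω - 1 / 2) P :=
    integrable_condExp.sub (integrable_const _)
  have hind : Integrable (A.indicator fun _ => (1 : ℝ)) P := (integrable_const 1).indicator hA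
  have hset (s : Set Ω) (hs : MeasurableSet[m] s) :
      ∫ ω in s, ((P⟦A | m⟧) ω - 1 / 2) ∂P = P.real (s ∩ A) - P.real s / 2 := by
    rw [integral_sub integrable_condExp.integrableOn (integrable_const _).integrableOn,
      setIntegral_condExp hm hind hs, setIntegral_indicator hA, setIntegral_const,
      setIntegral_const, smul_eq_mul, smul_eq_mul]
    ring
  -- The difference is tested against `1` on `T` and `-1` on its complement.
  have h1 : ∫ ω in T, ((P⟦A | m⟧) ω - 1 / 2) ∂P ≤ ∫ ω in T, |(P⟦A | m⟧) ω - 1 / 2| ∂P :=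
    setIntegral_mono hint.integrableOn hint.abs.integrableOn fun _ => le_abs_self _
  have h2 : -∫ ω in Tᶜ, ((P⟦A | m⟧) ω - 1 / 2) ∂P ≤
      ∫ ω in Tᶜ, |(P⟦A | m⟧) ω - 1 / 2| ∂P := by
    rw [← integral_neg]
    exact setIntegral_mono hint.neg.integrableOn hint.abs.integrableOn fun _ => neg_le_abs _
  rw [hset T hT] at h1
  rw [hset Tᶜ hT.compl] at h2
  rw [← integral_add_compl hT₀ hint.abs]
  have e1 : P.real (T ∩ A) + P.real (T \ A) = P.real T := measureReal_inter_add_sdiff hA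
  have e2 : P.real (A ∩ T) + P.real (A \ T) = P.real A := measureReal_inter_add_sdiff hT₀
  have e3 : P.real (symmDiff A T) = P.real (A \ T) + P.real (T \ A) :=
    measureReal_union disjoint_sdiff_sdiff (hT₀.diff hA)
  have e4 : P.real T + P.real Tᶜ = 1 := probReal_add_probReal_compl hT₀
  rw [show Tᶜ ∩ A = A \ T by rw [Set.inter_comm]; rfl] at h2
  linarith

open Classical in
/-- The event that some self-avoiding walk that starts on column `0`, at distance less than its
length from the top row, has noise `-1` on at least half of its bonds. -/
def badEvent (n : ℕ) : Set Sample :=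
  ⋃ i ∈ Finset.range n, ⋃ l ∈ (walks (i + 1) (true, (n : ℤ) - i, 0)).filter List.Nodup,
    halfBad l.toFinset

/-- Since `180 ^ 2 = 32400`, the hypothesis gives `√p ≤ 1 / 180`. The `18 ^ m` walks of length `m`
then contribute at most `(36 * √p) ^ m ≤ (1 / 5) ^ m`, and the geometric series from `m = 1` sums to
`1 / 4`. -/
lemma law_real_badEvent_le {p : unitInterval} (hp : (p : ℝ) < 1 / 32400) (n : ℕ) :
    (law p).real (badEvent n) ≤ 1 / 4 := by
  classical
  set s : ℝ := √p with hs
  have hs0 : 0 ≤ s := Real.sqrt_nonneg _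
  have hsp : s ^ 2 = p := Real.sq_sqrt p.2.1
  have hs1 : s ≤ 1 / 180 := by
    refine Real.sqrt_le_iff.2 ⟨by norm_num, ?_⟩
    norm_num at hp ⊢
    exact hp.le
  have hwalks (i : ℕ) : (law p).real
      (⋃ l ∈ (walks (i + 1) (true, (n : ℤ) - i, 0)).filter List.Nodup, halfBad l.toFinset) ≤
        (1 / 5) ^ (i + 1) := by
    calc _ ≤ ∑ l ∈ (walks (i + 1) (true, (n : ℤ) - i, 0)).filter List.Nodup,
          (law p).real (halfBad l.toFinset) := measureReal_biUnion_finset_le _ _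
      _ ≤ ∑ l ∈ (walks (i + 1) (true, (n : ℤ) - i, 0)).filter List.Nodup,
          (2 * s) ^ (i + 1) := by
        refine Finset.sum_le_sum fun l hl => ?_
        obtain ⟨hl, hnd⟩ := Finset.mem_filter.1 hl
        refine (law_real_halfBad_le p hs0 (by linarith) hsp _).trans ?_
        rw [List.toFinset_card_of_nodup hnd, length_of_mem_walks hl]
      _ ≤ 18 ^ (i + 1) * (2 * s) ^ (i + 1) := by
        rw [Finset.sum_const, nsmul_eq_mul]
        refine mul_le_mul_of_nonneg_right ?_ (by positivity)
        exact_mod_cast (Finset.card_filter_le _ _).trans (card_walks_le _ _)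
      _ ≤ (1 / 5) ^ (i + 1) := by
        rw [← mul_pow]
        exact pow_le_pow_left₀ (by positivity) (by linarith) _
  have hgeom : ∑ i ∈ Finset.range n, (1 / 5 : ℝ) ^ (i + 1) ≤ 1 / 4 := by
    have (m : ℕ) : ∑ i ∈ Finset.range m, (1 / 5 : ℝ) ^ (i + 1) = 1 / 4 - 1 / 4 * (1 / 5) ^ m := by
      induction m with
      | zero => simp
      | succ m ih => rw [Finset.sum_range_succ, ih]; ring
    rw [this]
    linarith [show (0 : ℝ) ≤ 1 / 4 * (1 / 5) ^ n by positivity]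
  exact (measureReal_biUnion_finset_le _ _).trans
    ((Finset.sum_le_sum fun i _ => hwalks i).trans hgeom)

lemma noise_eq_neg_of_obs_eq {e : Edge} {ω ω' : Sample} (h : obs e ω = obs e ω')
    (hd : ω.1 e.2 * ω'.1 e.2 ≠ ω.1 (tip e) * ω'.1 (tip e)) : noise e ω' = -noise e ω := by
  unfold obs at h
  generalize ω.1 e.2 = a at *
  generalize ω'.1 e.2 = a' at *
  generalize ω.1 (tip e) = b at *
  generalize ω'.1 (tip e) = b' at *
  generalize noise e ω = c at *
  generalize noise e ω' = c' at *
  revert a a' b b' c c'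
  decide

/-- Outside the bad event, the data determine the spin at `(n, 0)`. -/
lemma spin_eq_of_data_eq {n : ℕ} {ω ω' : Sample} (hω : ω ∉ badEvent n) (hω' : ω' ∉ badEvent n)
    (hX : dataX n ω = dataX n ω') (hY : dataY n n ω = dataY n n ω') :
    ω.1 (n, 0) = ω'.1 (n, 0) := by
  classical
  by_contra hne
  obtain ⟨i, hi, l, hl, hnd, hF⟩ := exists_interface_walk (n := n)
    (d := fun s => ω.1 s * ω'.1 s) (fun v hv => by
      have : ω.1 (0, (v : ℤ)) = ω'.1 (0, (v : ℤ)) :=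
        congrFun hX ⟨v, Finset.mem_Icc.2 ⟨by omega, by omega⟩⟩
      simp only [this, units_int_mul_self]) (units_int_mul_eq _ _ hne)
  have hlt (η : Sample) (hη : η ∉ badEvent n) :
      2 * (l.toFinset.filter fun e => noise e η = -1).card < l.toFinset.card := by
    by_contra! h
    refine hη ?_
    simp only [badEvent, Set.mem_iUnion]
    exact ⟨i, Finset.mem_range.2 hi, l, Finset.mem_filter.2 ⟨hl, hnd⟩, h⟩
  -- The noises are opposite along the walk, so the two counts of noise `-1` add up to its length
  -- and cannot both be less than half of it.
  have hflip : (l.toFinset.filter fun e => ¬ noise e ω = -1) =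
      l.toFinset.filter fun e => noise e ω' = -1 := by
    refine Finset.filter_congr fun e he => ?_
    have heF := hF e (List.mem_toFinset.1 he)
    have := noise_eq_neg_of_obs_eq (congrFun hY ⟨e, heF.1⟩) heF.2
    rw [this]
    generalize noise e ω = c
    revert c; decide
  have hsum := Finset.card_filter_add_card_filter_not (s := l.toFinset)
    (fun e => noise e ω = -1)
  rw [hflip] at hsum
  have h1 := hlt ω hω
  have h2 := hlt ω' hω'
  omega

theorem not_filterStable {p : unitInterval} (hp : (p : ℝ) < 1 / 32400) :
    ¬ FilterStable (law p) X Y := by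
  intro hstab
  have hA : MeasurableSet {x : ℤ → ℤˣ | x 0 = 1} :=
    measurable_pi_apply (0 : ℤ) (.of_discrete (s := {1}))
  have hlow (n : ℕ) : 1 / 4 ≤ ∫ ω, |((law p)⟦X n ⁻¹' {x | x 0 = 1} | initObsSigma X Y n⟧) ω -
      ((law p)⟦X n ⁻¹' {x | x 0 = 1} | obsSigma Y n⟧) ω| ∂law p := by
    set A : Set Sample := X n ⁻¹' {x | x 0 = 1} with hAdef
    have hA' : MeasurableSet A := measurable_X n hA
    have hhalf := condExp_eq_half_of_invariants (measurePreserving_flip p)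
      (obsSigma_le_invariants n) hA' (by
        ext ω
        simp only [hAdef, X, spin, flip, Set.mem_preimage, Set.mem_compl_iff, Set.mem_ofPred_eq]
        generalize ω.1 (n, 0) = a
        revert a; decide)
    let f : Sample → _ := fun ω => (dataX n ω, dataY n n ω)
    -- `T` collects the points whose data occur at some good point of `A`. Good points with equal
    -- data have equal spins at `(n, 0)`, so `T` and `A` differ only inside the bad event.
    let T : Set Sample := f ⁻¹' (f '' (A \ badEvent n))
    have hT : MeasurableSet[initObsSigma X Y n] T := measurable_data n n .of_discrete
    have hAT : symmDiff A T ⊆ badEvent n := by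
      rintro ω (⟨hωA, hωT⟩ | ⟨⟨ω', ⟨hω'A, hω'⟩, hf⟩, hωA⟩)
      · by_contra hω
        exact hωT ⟨ω, ⟨hωA, hω⟩, rfl⟩
      · by_contra hω
        refine hωA ?_
        have := spin_eq_of_data_eq hω' hω (congrArg Prod.fst hf) (congrArg Prod.snd hf)
        exact this.symm.trans hω'A
    have h := half_sub_le_integral_abs_condExp_sub (P := law p) (initObsSigma_le n) hA' hT
    have h' := (measureReal_mono hAT (measure_ne_top _ _)).trans (law_real_badEvent_le hp n)
    refine (by linarith : (1 / 4 : ℝ) ≤ _).trans (h.trans_eq (integral_congr_ae ?_))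
    filter_upwards [hhalf] with ω hω
    rw [hω]
  have := ge_of_tendsto' (hstab _ hA) hlow
  norm_num at this

/-! ### Disagreement percolation for two replicas -/

/-- In the expansion of `∏ e ∈ F, (r e + c)`, the terms that select `r` on all of `l` contribute
at most `q ^ #l` times the product when `r ≤ q (r + c)`. -/
lemma sum_superset_le {E : Type*} [DecidableEq E] {F l : Finset E} (hl : l ⊆ F) {r : E → ℝ}
    {c q : ℝ} (hc : 0 ≤ c) (hr : ∀ e, 0 ≤ r e) (hrq : ∀ e, r e ≤ q * (r e + c)) :
    ∑ B ∈ F.powerset, (if l ⊆ B then (∏ e ∈ B, r e) * ∏ _e ∈ F \ B, c else 0) ≤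
      q ^ l.card * ∏ e ∈ F, (r e + c) := by
  -- Replacing `c` by `0` on `l` removes exactly the selections that omit a bond of `l`, and the sum
  -- becomes a product again.
  calc _ = ∑ B ∈ F.powerset, (∏ e ∈ B, r e) * ∏ e ∈ F \ B, (if e ∈ l then 0 else c) := by
        refine Finset.sum_congr rfl fun B hB => ?_
        split_ifs with h
        · congr 1
          exact Finset.prod_congr rfl fun e he =>
            (if_neg fun hel => (Finset.mem_sdiff.1 he).2 (h hel)).symm
        · obtain ⟨e, hel, heB⟩ := Finset.not_subset.1 h
          rw [Finset.prod_eq_zero (f := fun e => if e ∈ l then 0 else c) (Finset.mem_sdiff.2 ⟨hl hel, heB⟩) (if_pos hel),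
            mul_zero]
    _ = ∏ e ∈ F, (r e + if e ∈ l then 0 else c) := (Finset.prod_add _ _ _).symm
    _ ≤ ∏ e ∈ F, ((if e ∈ l then q else 1) * (r e + c)) := by
        refine Finset.prod_le_prod (fun e _ => ?_) fun e _ => ?_
        · split_ifs <;> linarith [hr e]
        · split_ifs <;> linarith [hrq e]
    _ = q ^ l.card * ∏ e ∈ F, (r e + c) := by
        rw [Finset.prod_mul_distrib, Finset.prod_ite_mem, Finset.prod_const,
          Finset.inter_eq_right.2 hl]

/-- The unnormalized posterior weight of a spin configuration given observations on `F`. -/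
def gibbs (p : ℝ) (F : Finset Edge) (y : Edge → ℤˣ) (x : ℤ × ℤ → ℤˣ) : ℝ :=
  ∏ e ∈ F, weight p (y e * x e.2 * x (tip e))

/-- The excess over its minimum of the weight of a bond in a pair of replicas. -/
def excess (p : ℝ) (y : Edge → ℤˣ) (x x' : ℤ × ℤ → ℤˣ) (e : Edge) : ℝ :=
  weight p (y e * x e.2 * x (tip e)) * weight p (y e * x' e.2 * x' (tip e)) - p ^ 2

lemma excess_nonneg {p : ℝ} (hp0 : 0 ≤ p) (hp : p ≤ 1 / 2) (y : Edge → ℤˣ)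
    (x x' : ℤ × ℤ → ℤˣ) (e : Edge) : 0 ≤ excess p y x x' e := by
  have h (z : ℤˣ) : p ≤ weight p z := by unfold weight; split_ifs <;> linarith
  unfold excess
  nlinarith [h (y e * x e.2 * x (tip e)), h (y e * x' e.2 * x' (tip e))]

/-- The pair weight is at most `(1 - p) ^ 2`, so its minimum `p ^ 2` is at least the fraction `(p /
(1 - p)) ^ 2` of it. -/
lemma excess_le {p : ℝ} (hp0 : 0 ≤ p) (hp : p ≤ 1 / 2) (y : Edge → ℤˣ)
    (x x' : ℤ × ℤ → ℤˣ) (e : Edge) :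
    excess p y x x' e ≤ (1 - (p / (1 - p)) ^ 2) * (excess p y x x' e + p ^ 2) := by
  have h0 (z : ℤˣ) : 0 ≤ weight p z := by unfold weight; split_ifs <;> linarith
  have h1 (z : ℤˣ) : weight p z ≤ 1 - p := by unfold weight; split_ifs <;> linarith
  set w := weight p (y e * x e.2 * x (tip e)) * weight p (y e * x' e.2 * x' (tip e)) with hw
  have hle : w ≤ (1 - p) ^ 2 := by
    rw [hw, sq]; exact mul_le_mul (h1 _) (h1 _) (h0 _) (by linarith)
  have hex : excess p y x x' e = w - p ^ 2 := rfl
  rw [hex, sub_add_cancel]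
  have : (p / (1 - p)) ^ 2 * w ≤ p ^ 2 := by
    rw [div_pow, div_mul_eq_mul_div, div_le_iff₀ (by nlinarith)]
    exact mul_le_mul_of_nonneg_left hle (sq_nonneg _)
  linarith

open Classical in
/-- Exchanging two replicas on a set of sites that no bond of `B` leaves preserves the
product of the bond excesses over `B`. -/
lemma prod_excess_swap (p : ℝ) (y : Edge → ℤˣ) {B : Finset Edge} {C : Set (ℤ × ℤ)}
    (hC : ∀ e ∈ B, e.2 ∈ C ↔ tip e ∈ C) (x x' : ℤ × ℤ → ℤˣ) :
    ∏ e ∈ B, excess p y (C.piecewise x' x) (C.piecewise x x') e =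
      ∏ e ∈ B, excess p y x x' e := by
  refine Finset.prod_congr rfl fun e he => ?_
  by_cases h : e.2 ∈ C
  · have h' := (hC e he).1 h
    simp only [excess, Set.piecewise_eq_of_mem _ _ _ h, Set.piecewise_eq_of_mem _ _ _ h']
    ring
  · have h' : tip e ∉ C := fun h' => h ((hC e he).2 h')
    simp only [excess, Set.piecewise_eq_of_notMem _ _ _ h, Set.piecewise_eq_of_notMem _ _ _ h']

open Classical in
/-- Disagreement percolation in a pair of replicas with the same bond signs: the expectations of
`φ` in the two replicas differ at most by the weight of the selections of bonds that contain a
connection from the sites on which `φ` depends to the sites where the replicas are fixed. -/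
lemma abs_sum_sum_sub_le {p : ℝ} (hp0 : 0 ≤ p) (hp : p ≤ 1 / 2) {F : Finset Edge}
    (y : Edge → ℤˣ) {𝒳 𝒳' : Finset (ℤ × ℤ → ℤˣ)} {φ : (ℤ × ℤ → ℤˣ) → ℝ}
    (hφ : ∀ x x', |φ x - φ x'| ≤ 1) {𝓛 : Finset (Finset Edge)} (h𝓛 : ∀ l ∈ 𝓛, l ⊆ F)
    (hsep : ∀ B ⊆ F, (∃ l ∈ 𝓛, l ⊆ B) ∨ ∃ C : Set (ℤ × ℤ), (∀ e ∈ B, e.2 ∈ C ↔ tip e ∈ C) ∧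
      (∀ x ∈ 𝒳, ∀ x' ∈ 𝒳', C.piecewise x' x ∈ 𝒳 ∧ C.piecewise x x' ∈ 𝒳') ∧
      ∀ x x', φ (C.piecewise x' x) = φ x') :
    |∑ x ∈ 𝒳, ∑ x' ∈ 𝒳', (φ x - φ x') * (gibbs p F y x * gibbs p F y x')| ≤
      (∑ l ∈ 𝓛, (1 - (p / (1 - p)) ^ 2) ^ l.card) *
        ∑ x ∈ 𝒳, ∑ x' ∈ 𝒳', gibbs p F y x * gibbs p F y x' := by
  set q : ℝ := 1 - (p / (1 - p)) ^ 2 with hq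
  let ρ (B : Finset Edge) (z : (ℤ × ℤ → ℤˣ) × (ℤ × ℤ → ℤˣ)) : ℝ :=
    (∏ e ∈ B, excess p y z.1 z.2 e) * ∏ _e ∈ F \ B, p ^ 2
  have hρ0 (B z) : 0 ≤ ρ B z := mul_nonneg
    (Finset.prod_nonneg fun e _ => excess_nonneg hp0 hp y _ _ e)
    (Finset.prod_nonneg fun _ _ => sq_nonneg p)
  have hprod (z : (ℤ × ℤ → ℤˣ) × (ℤ × ℤ → ℤˣ)) : gibbs p F y z.1 * gibbs p F y z.2 =
      ∏ e ∈ F, (excess p y z.1 z.2 e + p ^ 2) := by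
    simp only [gibbs, excess, sub_add_cancel, Finset.prod_mul_distrib]
  have hexp (z : (ℤ × ℤ → ℤˣ) × (ℤ × ℤ → ℤˣ)) : gibbs p F y z.1 * gibbs p F y z.2 =
      ∑ B ∈ F.powerset, ρ B z := by
    rw [hprod, Finset.prod_add]
  have hterm (B : Finset Edge) (hB : B ⊆ F) :
      |∑ z ∈ 𝒳 ×ˢ 𝒳', (φ z.1 - φ z.2) * ρ B z| ≤
        ∑ l ∈ 𝓛, ∑ z ∈ 𝒳 ×ˢ 𝒳', if l ⊆ B then ρ B z else 0 := by
    have hnn (l) : 0 ≤ ∑ z ∈ 𝒳 ×ˢ 𝒳', if l ⊆ B then ρ B z else 0 :=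
      Finset.sum_nonneg fun z _ => by split_ifs; exacts [hρ0 B z, le_rfl]
    rcases hsep B hB with ⟨l, hl, hlB⟩ | ⟨C, hC, h𝒳, hφC⟩
    · calc _ ≤ ∑ z ∈ 𝒳 ×ˢ 𝒳', |(φ z.1 - φ z.2) * ρ B z| := Finset.abs_sum_le_sum_abs _ _
        _ ≤ ∑ z ∈ 𝒳 ×ˢ 𝒳', if l ⊆ B then ρ B z else 0 := by
          refine Finset.sum_le_sum fun z _ => ?_
          rw [if_pos hlB, abs_mul, abs_of_nonneg (hρ0 B z)]
          exact mul_le_of_le_one_left (hρ0 B z) (hφ _ _)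
        _ ≤ _ := Finset.single_le_sum (f := fun l => ∑ z ∈ 𝒳 ×ˢ 𝒳', if l ⊆ B then ρ B z else 0)
          (fun l _ => hnn l) hl
    -- Exchanging the replicas on `C` preserves the weight and swaps the two values of `φ`, so the
    -- terms cancel along an involution; at a fixed point the term equals its own negative.
    · have hanti (z : (ℤ × ℤ → ℤˣ) × (ℤ × ℤ → ℤˣ)) : (φ z.1 - φ z.2) * ρ B z +
          (φ (C.piecewise z.2 z.1) - φ (C.piecewise z.1 z.2)) *
            ρ B (C.piecewise z.2 z.1, C.piecewise z.1 z.2) = 0 := by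
        simp only [hφC, ρ, prod_excess_swap p y hC]
        ring
      have hzero : ∑ z ∈ 𝒳 ×ˢ 𝒳', (φ z.1 - φ z.2) * ρ B z = 0 := by
        refine Finset.sum_involution
          (fun z _ => (C.piecewise z.2 z.1, C.piecewise z.1 z.2)) (fun z _ => hanti z) ?_ ?_ ?_
        · intro z _ hz heq
          have h := hanti z
          rw [Prod.ext_iff] at heq
          simp only at heq
          rw [heq.1, heq.2] at h
          exact hz (by simpa using h)
        · intro z hz
          rw [Finset.mem_product] at hz ⊢
          exact h𝒳 _ hz.1 _ hz.2
        · intro z _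
          ext s <;> by_cases hs : s ∈ C <;> simp [hs]
      rw [hzero, abs_zero]
      exact Finset.sum_nonneg fun l _ => hnn l
  have hl (l : Finset Edge) (hl : l ∈ 𝓛) (z : (ℤ × ℤ → ℤˣ) × (ℤ × ℤ → ℤˣ)) :
      ∑ B ∈ F.powerset, (if l ⊆ B then ρ B z else 0) ≤
        q ^ l.card * (gibbs p F y z.1 * gibbs p F y z.2) := by
    rw [hprod]
    exact sum_superset_le (h𝓛 l hl) (sq_nonneg p) (excess_nonneg hp0 hp y z.1 z.2)
      (excess_le hp0 hp y z.1 z.2)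
  rw [← Finset.sum_product', ← Finset.sum_product']
  calc |∑ z ∈ 𝒳 ×ˢ 𝒳', (φ z.1 - φ z.2) * (gibbs p F y z.1 * gibbs p F y z.2)|
      = |∑ B ∈ F.powerset, ∑ z ∈ 𝒳 ×ˢ 𝒳', (φ z.1 - φ z.2) * ρ B z| := by
        rw [Finset.sum_comm]
        simp_rw [hexp, Finset.mul_sum]
    _ ≤ ∑ B ∈ F.powerset, ∑ l ∈ 𝓛, ∑ z ∈ 𝒳 ×ˢ 𝒳', (if l ⊆ B then ρ B z else 0) :=
        (Finset.abs_sum_le_sum_abs _ _).trans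
          (Finset.sum_le_sum fun B hB => hterm B (Finset.mem_powerset.1 hB))
    _ = ∑ l ∈ 𝓛, ∑ z ∈ 𝒳 ×ˢ 𝒳', ∑ B ∈ F.powerset, (if l ⊆ B then ρ B z else 0) := by
        rw [Finset.sum_comm]
        exact Finset.sum_congr rfl fun l _ => Finset.sum_comm
    _ ≤ ∑ l ∈ 𝓛, ∑ z ∈ 𝒳 ×ˢ 𝒳', q ^ l.card * (gibbs p F y z.1 * gibbs p F y z.2) :=
        Finset.sum_le_sum fun l hl' => Finset.sum_le_sum fun z _ => hl l hl' z
    _ = _ := by simp_rw [← Finset.mul_sum, Finset.sum_mul]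

/-- A site is an endpoint of a bond. -/
def Touches (e : Edge) (s : ℤ × ℤ) : Prop := s = e.2 ∨ s = tip e

lemma Touches.bounds {e : Edge} {s : ℤ × ℤ} (h : Touches e s) :
    (s.1 ≤ e.2.1 ∧ e.2.1 ≤ s.1 + 1) ∧ (s.2 - 1 ≤ e.2.2 ∧ e.2.2 ≤ s.2) := by
  obtain ⟨_ | _, j, v⟩ := e <;> rcases h with rfl | rfl <;> simp [tip]

lemma Touches.mem_nbr {e f : Edge} {s : ℤ × ℤ} (he : Touches e s) (hf : Touches f s) :
    f ∈ nbr e := by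
  have h1 := he.bounds
  have h2 := hf.bounds
  rw [SpinModel.mem_nbr, abs_le, abs_le]
  refine ⟨⟨?_, ?_⟩, ?_, ?_⟩ <;> omega

/-- Either a set of bonds of the box contains a walk of length `n` from the sites `(n, v)`,
`v ∈ S`, or these sites are separated from time `0` by a set of sites that no bond leaves. -/
lemma exists_walk_or_separated {n L : ℕ} (hn : 1 ≤ n) (S : Finset ℤ) {B : Finset Edge}
    (hB : B ⊆ box n L) :
    (∃ v ∈ S, ∃ e ∈ nbr (true, (n : ℤ), v), ∃ l ∈ walks n e, l.Nodup ∧ ∀ g ∈ l, g ∈ B) ∨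
    ∃ C : Set (ℤ × ℤ), (∀ e ∈ B, e.2 ∈ C ↔ tip e ∈ C) ∧ (∀ v, (0, v) ∉ C) ∧
      ∀ v ∈ S, ((n : ℤ), v) ∈ C := by
  refine or_iff_not_imp_left.2 fun hcon => ?_
  let K : Set Edge := {e | e ∈ B ∧ ∃ v ∈ S, ∃ f ∈ B, Touches f (n, v) ∧
    (bondGraph (B : Set Edge)).Reachable f e}
  -- The target sites together with all endpoints of bonds of `B` connected to them.
  let C : Set (ℤ × ℤ) := {s | (∃ v ∈ S, s = ((n : ℤ), v)) ∨ ∃ e ∈ K, Touches e s}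
  have hK (e : Edge) (he : e ∈ B) (s : ℤ × ℤ) (hs : Touches e s) (hsC : s ∈ C) : e ∈ K := by
    rcases hsC with ⟨v, hv, rfl⟩ | ⟨e', ⟨he'B, v, hv, f, hf, hfv, hr⟩, he's⟩
    · exact ⟨he, v, hv, e, he, hs, SimpleGraph.Reachable.refl _⟩
    · refine ⟨he, v, hv, f, hf, hfv, ?_⟩
      by_cases hee : e' = e
      · exact hee ▸ hr
      · exact hr.trans (SimpleGraph.Adj.reachable ⟨hee, he'B, he, he's.mem_nbr hs⟩)
  refine ⟨C, fun e he => ⟨fun h => ?_, fun h => ?_⟩, ?_, fun v hv => .inl ⟨v, hv, rfl⟩⟩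
  · exact .inr ⟨e, hK e he _ (.inl rfl) h, .inr rfl⟩
  · exact .inr ⟨e, hK e he _ (.inr rfl) h, .inl rfl⟩
  · rintro w (⟨v, -, h⟩ | ⟨e, ⟨heB, v, hv, f, hf, hfv, hr⟩, hew⟩)
    · have := congrArg Prod.fst h
      simp at this
      omega
    · refine hcon ⟨v, hv, f, ?_, ?_⟩
      · exact Touches.mem_nbr (s := (n, v)) (.inl rfl) hfv
      -- In the box, a bond touching time `0` has time label `1` and one touching time `n` has time
      -- label `n`, so a path between them has at least `n` bonds.
      · refine exists_nodup_walk hf hr (.inl ?_)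
        have h1 := (mem_box.1 (hB heB)).1
        have h2 := (mem_box.1 (hB hf)).1
        have h3 := hew.bounds.1
        have h4 := hfv.bounds.1
        simp only at h3 h4
        linarith [le_abs_self (f.2.1 - e.2.1)]

open Classical in
/-- The bond sets of the self-avoiding walks of length `n` from the sites `(n, v)`, `v ∈ S`,
inside the box. -/
def connections (n L : ℕ) (S : Finset ℤ) : Finset (Finset Edge) :=
  (S.biUnion fun v => (nbr (true, (n : ℤ), v)).biUnion fun e =>
    ((walks n e).filter List.Nodup).image List.toFinset).filter fun l => l ⊆ box n L

/-- The factors count the site `v`, the first bond near it, and the walks of length `n` from that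
bond. -/
lemma sum_connections_le (n L : ℕ) (S : Finset ℤ) {q : ℝ} (hq : 0 ≤ q) :
    ∑ l ∈ connections n L S, q ^ l.card ≤ S.card * 18 * (18 * q) ^ n := by
  classical
  have hcard : ∀ l ∈ connections n L S, q ^ l.card = q ^ n := by
    intro l hl
    simp only [connections, Finset.mem_filter, Finset.mem_biUnion, Finset.mem_image] at hl
    obtain ⟨⟨v, -, e, -, l', ⟨hl', hnd⟩, rfl⟩, -⟩ := hl
    rw [List.toFinset_card_of_nodup hnd, length_of_mem_walks hl']
  have hle : (connections n L S).card ≤ S.card * (18 * 18 ^ n) := by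
    refine (Finset.card_filter_le _ _).trans (Finset.card_biUnion_le_card_mul _ _ _ fun v _ => ?_)
    refine (Finset.card_biUnion_le_card_mul _ _ (18 ^ n) fun e _ => ?_).trans (by rw [card_nbr])
    exact Finset.card_image_le.trans ((Finset.card_filter_le _ _).trans (card_walks_le n e))
  rw [Finset.sum_congr rfl hcard, Finset.sum_const, nsmul_eq_mul, mul_pow]
  calc ((connections n L S).card : ℝ) * q ^ n ≤ ((S.card * (18 * 18 ^ n) : ℕ) : ℝ) * q ^ n :=
        mul_le_mul_of_nonneg_right (by exact_mod_cast hle) (pow_nonneg hq n)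
    _ = _ := by push_cast; ring

/-! ### Conditional probabilities given finite data -/

/-- The product form determines `h` on atoms of positive probability and needs no division on null
atoms. -/
lemma exists_condExp_eq_comp {Ω γ : Type*} [MeasurableSpace Ω] {P : Measure Ω}
    [IsProbabilityMeasure P] [MeasurableSpace γ] [DiscreteMeasurableSpace γ] {W : Ω → γ}
    (hW : Measurable W) {A : Set Ω} (hA : MeasurableSet A) :
    ∃ h : γ → ℝ, P⟦A | MeasurableSpace.comap W inferInstance⟧ = h ∘ W ∧
      ∀ c, h c * P.real (W ⁻¹' {c}) = P.real (A ∩ W ⁻¹' {c}) := by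
  obtain ⟨h, -, hh⟩ := (stronglyMeasurable_condExp (μ := P) (f := A.indicator fun _ => (1 : ℝ))
    (m := MeasurableSpace.comap W inferInstance)).exists_eq_measurable_comp
  refine ⟨h, hh, fun c => ?_⟩
  have hc : MeasurableSet (W ⁻¹' {c}) := hW .of_discrete
  have h1 := setIntegral_condExp hW.comap_le (μ := P) (f := A.indicator fun _ => (1 : ℝ))
    (s := W ⁻¹' {c}) ((integrable_const 1).indicator hA) ⟨{c}, .of_discrete, rfl⟩
  rw [hh, setIntegral_indicator hA, setIntegral_const,
    setIntegral_congr_fun (g := fun _ => h c) hc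
      (fun ω hω => by simp only [Function.comp_apply]; rw [show W ω = c from hω]),
    setIntegral_const, smul_eq_mul, smul_eq_mul, mul_one] at h1
  rw [Set.inter_comm, ← h1, mul_comm]

lemma sum_measureReal_inter_fiber {Ω α : Type*} [MeasurableSpace Ω] (P : Measure Ω)
    [IsProbabilityMeasure P] [Fintype α] [MeasurableSpace α] [DiscreteMeasurableSpace α]
    {U : Ω → α} (hU : Measurable U) {T : Set Ω} (hT : MeasurableSet T) :
    ∑ a, P.real (T ∩ U ⁻¹' {a}) = P.real T := by
  rw [← measureReal_biUnion_finset (μ := P) (s := Finset.univ) (f := fun a => T ∩ U ⁻¹' {a})]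
  · congr 1
    ext ω
    simp
  · intro a _ b _ hab
    refine Set.disjoint_left.2 fun ω h1 h2 => hab ?_
    exact h1.2.symm.trans h2.2
  · exact fun a _ => hT.inter (hU .of_discrete)

/-- If the conditional probabilities of `A` given `U = a, V = b` vary at most by `ε` with `a`,
then observing `U` in addition to `V` changes the conditional probability of `A` at most
by `ε`. -/
lemma integral_abs_condExp_sub_le {Ω α β : Type*} [MeasurableSpace Ω] {P : Measure Ω}
    [IsProbabilityMeasure P] [Fintype α] [MeasurableSpace α] [DiscreteMeasurableSpace α]
    [Fintype β] [MeasurableSpace β] [DiscreteMeasurableSpace β] {U : Ω → α} {V : Ω → β}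
    (hU : Measurable U) (hV : Measurable V) {A : Set Ω} (hA : MeasurableSet A) {ε : ℝ}
    (h : ∀ a a' b,
      |P.real (A ∩ (V ⁻¹' {b} ∩ U ⁻¹' {a})) * P.real (V ⁻¹' {b} ∩ U ⁻¹' {a'}) -
        P.real (A ∩ (V ⁻¹' {b} ∩ U ⁻¹' {a'})) * P.real (V ⁻¹' {b} ∩ U ⁻¹' {a})| ≤
      ε * (P.real (V ⁻¹' {b} ∩ U ⁻¹' {a}) * P.real (V ⁻¹' {b} ∩ U ⁻¹' {a'}))) :
    ∫ ω, |(P⟦A | MeasurableSpace.comap (fun ω => (U ω, V ω)) inferInstance⟧) ω -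
      (P⟦A | MeasurableSpace.comap V inferInstance⟧) ω| ∂P ≤ ε := by
  have hUV : Measurable fun ω => (U ω, V ω) := hU.prodMk hV
  obtain ⟨f, hf, hfc⟩ := exists_condExp_eq_comp (P := P) hUV hA
  obtain ⟨g, hg, hgc⟩ := exists_condExp_eq_comp (P := P) hV hA
  have hpair (a : α) (b : β) : (fun ω => (U ω, V ω)) ⁻¹' {(a, b)} = V ⁻¹' {b} ∩ U ⁻¹' {a} := by
    ext ω
    simp [and_comm]
  have hbound (a : α) (b : β) (hab : P.real (V ⁻¹' {b} ∩ U ⁻¹' {a}) ≠ 0) :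
      |f (a, b) - g b| ≤ ε := by
    have hVb : MeasurableSet (V ⁻¹' {b}) := hV .of_discrete
    have h1 : 0 < P.real (V ⁻¹' {b} ∩ U ⁻¹' {a}) := lt_of_le_of_ne measureReal_nonneg hab.symm
    have h2 : 0 < P.real (V ⁻¹' {b}) :=
      h1.trans_le (measureReal_mono Set.inter_subset_left (measure_ne_top _ _))
    have hf1 := hfc (a, b)
    rw [hpair] at hf1
    have hg1 := hgc b
    have hs1 := sum_measureReal_inter_fiber P hU hVb
    have hs2 := sum_measureReal_inter_fiber P hU (hA.inter hVb)
    simp_rw [Set.inter_assoc] at hs2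
    -- Summing the hypothesis over `a'` replaces conditioning on `U = a'` by no conditioning on `U`.
    have hsum : |P.real (A ∩ (V ⁻¹' {b} ∩ U ⁻¹' {a})) * P.real (V ⁻¹' {b}) -
        P.real (A ∩ V ⁻¹' {b}) * P.real (V ⁻¹' {b} ∩ U ⁻¹' {a})| ≤
        ε * (P.real (V ⁻¹' {b} ∩ U ⁻¹' {a}) * P.real (V ⁻¹' {b})) := by
      rw [← hs2, ← hs1, Finset.mul_sum, Finset.sum_mul, ← Finset.sum_sub_distrib,
        Finset.mul_sum, Finset.mul_sum]
      exact (Finset.abs_sum_le_sum_abs _ _).trans (Finset.sum_le_sum fun a' _ => h a a' b)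
    rw [← hf1, ← hg1] at hsum
    have hfac : f (a, b) * P.real (V ⁻¹' {b} ∩ U ⁻¹' {a}) * P.real (V ⁻¹' {b}) -
        g b * P.real (V ⁻¹' {b}) * P.real (V ⁻¹' {b} ∩ U ⁻¹' {a}) =
        (f (a, b) - g b) * (P.real (V ⁻¹' {b} ∩ U ⁻¹' {a}) * P.real (V ⁻¹' {b})) := by ring
    have hpos := mul_pos h1 h2
    rw [hfac, abs_mul, abs_of_pos hpos] at hsum
    exact le_of_mul_le_mul_right hsum hpos
  have hae : ∀ᵐ ω ∂P, P.real (V ⁻¹' {V ω} ∩ U ⁻¹' {U ω}) ≠ 0 := by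
    have : ∀ᵐ ω ∂P, ∀ c : α × β,
        P.real (V ⁻¹' {c.2} ∩ U ⁻¹' {c.1}) = 0 → ω ∉ V ⁻¹' {c.2} ∩ U ⁻¹' {c.1} := by
      refine ae_all_iff.2 fun c => ?_
      by_cases hc : P.real (V ⁻¹' {c.2} ∩ U ⁻¹' {c.1}) = 0
      · filter_upwards [measure_eq_zero_iff_ae_notMem.1
          ((measureReal_eq_zero_iff (measure_ne_top _ _)).1 hc)] with ω hω _ using hω
      · exact .of_forall fun ω h => absurd h hc
    filter_upwards [this] with ω hω h0
    exact hω (U ω, V ω) h0 ⟨rfl, rfl⟩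
  calc _ ≤ ∫ _ω, ε ∂P := by
        refine integral_mono_ae (integrable_condExp.sub integrable_condExp).abs
          (integrable_const ε) ?_
        filter_upwards [hae] with ω hω
        rw [hf, hg]
        exact hbound _ _ hω
    _ = ε := by simp

/-! ### Exponential forgetting in a finite box -/

/-- The sites that are endpoints of the bonds of the box, and those of time `0`. -/
def sites (n L : ℕ) : Finset (ℤ × ℤ) :=
  Finset.Icc (0 : ℤ) n ×ˢ Finset.Icc (-L : ℤ) (L + 1)

lemma mem_sites {n L : ℕ} {s : ℤ × ℤ} :
    s ∈ sites n L ↔ (0 ≤ s.1 ∧ s.1 ≤ n) ∧ -L ≤ s.2 ∧ s.2 ≤ (L : ℤ) + 1 := by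
  simp [sites]

/-- Column `L + 1` accommodates the tips of the space bonds in column `L`, and time `0` those of the
time bonds at time `1`. -/
lemma endpoints_mem_sites {n L : ℕ} {e : Edge} (he : e ∈ box n L) :
    e.2 ∈ sites n L ∧ tip e ∈ sites n L := by
  obtain ⟨b, j, v⟩ := e
  have h := mem_box.1 he
  simp only at h
  cases b <;> simp only [mem_sites, tip] <;> simp <;> omega

/-- The default value `1` outside the sites gives each local assignment a single representative. -/
lemma finite_configs (n L : ℕ) (u : ℤ → ℤˣ) :
    {x : ℤ × ℤ → ℤˣ | (∀ s ∉ sites n L, x s = 1) ∧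
      ∀ v ∈ Finset.Icc (-L : ℤ) (L + 1), x (0, v) = u v}.Finite := by
  refine Set.Finite.of_finite_image (f := fun x (s : sites n L) => x s) (Set.toFinite _) ?_
  intro x hx x' hx' h
  funext s
  by_cases hs : s ∈ sites n L
  · exact congrFun h ⟨s, hs⟩
  · rw [hx.1 s hs, hx'.1 s hs]

/-- The spin configurations in the box that agree with `u` at time `0`. -/
def configs (n L : ℕ) (u : ℤ → ℤˣ) : Finset (ℤ × ℤ → ℤˣ) := (finite_configs n L u).toFinset

lemma mem_configs {n L : ℕ} {u : ℤ → ℤˣ} {x : ℤ × ℤ → ℤˣ} : x ∈ configs n L u ↔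
    (∀ s ∉ sites n L, x s = 1) ∧ ∀ v ∈ Finset.Icc (-L : ℤ) (L + 1), x (0, v) = u v := by
  simp [configs]

open Classical in
/-- The probability of given data and a given local event for the spins. -/
lemma law_real_inter_data (p : unitInterval) (n L : ℕ) (u : ℤ → ℤˣ) (y : Edge → ℤˣ)
    {A : Set (ℤ × ℤ → ℤˣ)} (hA : ∀ x x', (∀ s ∈ sites n L, x s = x' s) → x ∈ A → x' ∈ A) :
    (law p).real {ω | ω.1 ∈ A ∧ (∀ e ∈ box n L, obs e ω = y e) ∧
      ∀ v ∈ Finset.Icc (-L : ℤ) (L + 1), ω.1 (0, v) = u v} =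
    (1 / 2) ^ (sites n L).card *
      ∑ x ∈ configs n L u, (if x ∈ A then 1 else 0) * gibbs p (box n L) y x := by
  -- Given the spins, the observations prescribe the noise, so the event is a disjoint union of
  -- cylinders with known probabilities.
  let cyl (x : ℤ × ℤ → ℤˣ) : Set Sample := {ω | (∀ s ∈ sites n L, ω.1 s = x s) ∧
    ∀ e ∈ box n L, noise e ω = y e * x e.2 * x (tip e)}
  have hcyl (x) : MeasurableSet (cyl x) := by
    have : cyl x = (⋂ s ∈ sites n L, coord (.inl s) ⁻¹' {x s}) ∩
        ⋂ e ∈ box n L, noise e ⁻¹' {y e * x e.2 * x (tip e)} := by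
      ext ω
      simp [cyl, coord]
    rw [this]
    exact (Finset.measurableSet_biInter _ fun s _ => measurable_coord _ .of_discrete).inter
      (Finset.measurableSet_biInter _ fun e _ => measurable_noise e .of_discrete)
  have hset : {ω : Sample | ω.1 ∈ A ∧ (∀ e ∈ box n L, obs e ω = y e) ∧
      ∀ v ∈ Finset.Icc (-L : ℤ) (L + 1), ω.1 (0, v) = u v} =
      ⋃ x ∈ (configs n L u).filter (· ∈ A), cyl x := by
    ext ω
    simp only [Set.mem_iUnion, Finset.mem_filter, Set.mem_ofPred_eq, exists_prop, cyl]
    have hswap : ∀ a b c d : ℤˣ, a * b * c = d ↔ c = d * a * b := by decide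
    constructor
    · rintro ⟨hωA, hobs, h0⟩
      have hx (s) (hs : s ∈ sites n L) :
          (fun s => if s ∈ sites n L then ω.1 s else 1) s = ω.1 s := if_pos hs
      refine ⟨fun s => if s ∈ sites n L then ω.1 s else 1, ⟨mem_configs.2 ⟨fun s hs => if_neg hs,
        fun v hv => (hx _ ?_).trans (h0 v hv)⟩, hA _ _ (fun s hs => (hx s hs).symm) hωA⟩,
        fun s hs => (hx s hs).symm, fun e he => ?_⟩
      · have := Finset.mem_Icc.1 hv
        exact mem_sites.2 ⟨⟨le_rfl, by positivity⟩, this⟩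
      · have hs := endpoints_mem_sites he
        have := hobs e he
        rw [obs, hswap] at this
        rw [this, hx _ hs.1, hx _ hs.2]
    · rintro ⟨x, ⟨hx, hxA⟩, hωx, hnoise⟩
      refine ⟨hA _ _ (fun s hs => (hωx s hs).symm) hxA, fun e he => ?_, fun v hv => ?_⟩
      · have hs := endpoints_mem_sites he
        rw [obs, hswap, hωx _ hs.1, hωx _ hs.2, hnoise e he]
      · rw [← (mem_configs.1 hx).2 v hv]
        have := Finset.mem_Icc.1 hv
        exact hωx _ (mem_sites.2 ⟨⟨le_rfl, by positivity⟩, this⟩)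
  rw [hset, measureReal_biUnion_finset (fun x hx x' hx' hne => ?_) (fun x _ => hcyl x)
    (fun x _ => measure_ne_top _ _)]
  · simp_rw [cyl, law_real_cylinder, Finset.sum_filter, Finset.mul_sum, ite_mul, one_mul,
      zero_mul, mul_ite, mul_zero]
    rfl
  · refine Set.disjoint_left.2 fun ω h h' => hne ?_
    have h1 := (mem_configs.1 (Finset.mem_filter.1 hx).1).1
    have h2 := (mem_configs.1 (Finset.mem_filter.1 hx').1).1
    funext s
    by_cases hs : s ∈ sites n L
    · rw [← h.1 s hs, h'.1 s hs]
    · rw [h1 s hs, h2 s hs]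

open Classical in
/-- In a box, the initial state changes the conditional probability of a local event at time
`n` given the observations by an amount exponentially small in `n`. -/
lemma integral_abs_condExp_box_le {p : unitInterval} (hp : (p : ℝ) ≤ 1 / 2) {n L : ℕ} (hn : 1 ≤ n)
    {S : Finset ℤ} (hS : S ⊆ Finset.Icc (-L : ℤ) (L + 1)) (S₀ : Set (S → ℤˣ)) :
    ∫ ω, |((law p)⟦X n ⁻¹' cylinder S S₀ |
        MeasurableSpace.comap (fun ω => (dataX L ω, dataY n L ω)) inferInstance⟧) ω -
      ((law p)⟦X n ⁻¹' cylinder S S₀ |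
        MeasurableSpace.comap (dataY n L) inferInstance⟧) ω| ∂law p ≤
      S.card * 18 * (18 * (1 - ((p : ℝ) / (1 - p)) ^ 2)) ^ n := by
  have hp0 : (0 : ℝ) ≤ p := p.2.1
  set q : ℝ := 1 - ((p : ℝ) / (1 - p)) ^ 2 with hq
  have hq0 : 0 ≤ q := by
    have h1 : (p : ℝ) / (1 - p) ≤ 1 := by rw [div_le_one (by linarith)]; linarith
    have h2 : 0 ≤ (p : ℝ) / (1 - p) := div_nonneg hp0 (by linarith)
    rw [hq]
    nlinarith
  let A : Set (ℤ × ℤ → ℤˣ) := {x | (fun v => x ((n : ℤ), v)) ∈ cylinder S S₀}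
  have hAS (x x' : ℤ × ℤ → ℤˣ) (h : ∀ v ∈ S, x (n, v) = x' (n, v)) : x ∈ A ↔ x' ∈ A := by
    have : S.restrict (fun v => x ((n : ℤ), v)) = S.restrict (fun v => x' ((n : ℤ), v)) :=
      funext fun v => h v v.2
    simp only [A, cylinder, Set.mem_ofPred_eq, Set.mem_preimage, this]
  have hAsites (x x' : ℤ × ℤ → ℤˣ) (h : ∀ s ∈ sites n L, x s = x' s) (hx : x ∈ A) : x' ∈ A := by
    refine (hAS x x' fun v hv => h _ ?_).1 hx
    exact mem_sites.2 ⟨⟨by simp, le_rfl⟩, Finset.mem_Icc.1 (hS hv)⟩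
  refine integral_abs_condExp_sub_le
    ((measurable_dataX L).mono (measurable_X 0).comap_le le_rfl)
    ((measurable_dataY n L).mono (obsSigma_le n) le_rfl)
    (measurable_X n (MeasurableSet.cylinder S (Set.toFinite _).measurableSet)) ?_
  intro a a' b
  let ext (a : Finset.Icc (-L : ℤ) (L + 1) → ℤˣ) (v : ℤ) : ℤˣ :=
    if h : v ∈ Finset.Icc (-L : ℤ) (L + 1) then a ⟨v, h⟩ else 1
  let y (e : Edge) : ℤˣ := if h : e ∈ box n L then b ⟨e, h⟩ else 1
  have hX (a) (ω : Sample) : ω ∈ dataX L ⁻¹' {a} ↔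
      ∀ v ∈ Finset.Icc (-L : ℤ) (L + 1), ω.1 (0, v) = ext a v := by
    rw [Set.mem_preimage, Set.mem_singleton_iff, funext_iff, Subtype.forall]
    refine forall₂_congr fun v hv => ?_
    simp only [ext, dif_pos hv]
    rfl
  have hY (ω : Sample) : ω ∈ dataY n L ⁻¹' {b} ↔ ∀ e ∈ box n L, obs e ω = y e := by
    rw [Set.mem_preimage, Set.mem_singleton_iff, funext_iff, Subtype.forall]
    refine forall₂_congr fun e he => ?_
    simp only [y, dif_pos he]
    rfl
  have h1 (a) : (law p).real (X n ⁻¹' cylinder S S₀ ∩ (dataY n L ⁻¹' {b} ∩ dataX L ⁻¹' {a})) =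
      (1 / 2) ^ (sites n L).card *
        ∑ x ∈ configs n L (ext a), (if x ∈ A then 1 else 0) * gibbs p (box n L) y x := by
    rw [← law_real_inter_data p n L (ext a) y hAsites]
    congr 1
    ext ω
    rw [Set.mem_inter_iff, Set.mem_inter_iff, hX, hY]
    rfl
  have h2 (a) : (law p).real (dataY n L ⁻¹' {b} ∩ dataX L ⁻¹' {a}) =
      (1 / 2) ^ (sites n L).card * ∑ x ∈ configs n L (ext a), gibbs p (box n L) y x := by
    have := law_real_inter_data p n L (ext a) y (A := Set.univ) fun _ _ _ _ => trivial
    simp only [Set.mem_univ, if_true, one_mul, true_and] at this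
    rw [← this]
    congr 1
    ext ω
    rw [Set.mem_inter_iff, hX, hY]
    rfl
  rw [h1, h1, h2, h2]
  -- In the separated case `C` avoids time `0`, so the exchange respects both initial states, and
  -- `C` contains the sites `(n, v)`, `v ∈ S`, so it exchanges the values of the indicator of `A`.
  have hmain := abs_sum_sum_sub_le hp0 hp (F := box n L) y (𝒳 := configs n L (ext a))
    (𝒳' := configs n L (ext a')) (φ := fun x => if x ∈ A then 1 else 0)
    (fun x x' => by split_ifs <;> simp) (𝓛 := connections n L S)
    (fun l hl => (Finset.mem_filter.1 hl).2) (fun B hB => by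
      rcases exists_walk_or_separated hn S hB with
        ⟨v, hv, e, he, l, hl, hnd, hlB⟩ | ⟨C, hC, hC0, hCS⟩
      · have hlB' : l.toFinset ⊆ B := fun g hg => hlB g (List.mem_toFinset.1 hg)
        refine .inl ⟨l.toFinset, Finset.mem_filter.2 ⟨?_, hlB'.trans hB⟩, hlB'⟩
        simp only [Finset.mem_biUnion, Finset.mem_image, Finset.mem_filter]
        exact ⟨v, hv, e, he, l, ⟨hl, hnd⟩, rfl⟩
      · refine .inr ⟨C, hC, fun x hx x' hx' => ?_, fun x x' => ?_⟩
        · rw [mem_configs] at hx hx' ⊢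
          rw [mem_configs]
          refine ⟨⟨fun s hs => ?_, fun v hv => ?_⟩, fun s hs => ?_, fun v hv => ?_⟩
          · by_cases h : s ∈ C <;> simp [h, hx.1 s hs, hx'.1 s hs]
          · rw [Set.piecewise_eq_of_notMem _ _ _ (hC0 v), hx.2 v hv]
          · by_cases h : s ∈ C <;> simp [h, hx.1 s hs, hx'.1 s hs]
          · rw [Set.piecewise_eq_of_notMem _ _ _ (hC0 v), hx'.2 v hv]
        · have := hAS (C.piecewise x' x) x' fun v hv =>
            Set.piecewise_eq_of_mem _ _ _ (hCS v hv)
          simp only [this])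
  set G := gibbs p (box n L) y
  set c : ℝ := (1 / 2) ^ (sites n L).card with hc
  have hc0 : 0 ≤ c := by positivity
  have hG (x) : 0 ≤ G x := Finset.prod_nonneg fun e _ => by
    unfold weight; split_ifs <;> linarith
  have e1 : ∑ x ∈ configs n L (ext a), ∑ x' ∈ configs n L (ext a'),
      ((if x ∈ A then (1 : ℝ) else 0) - if x' ∈ A then 1 else 0) * (G x * G x') =
      (∑ x ∈ configs n L (ext a), (if x ∈ A then 1 else 0) * G x) *
        (∑ x ∈ configs n L (ext a'), G x) -
      (∑ x ∈ configs n L (ext a'), (if x ∈ A then 1 else 0) * G x) *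
        (∑ x ∈ configs n L (ext a), G x) := by
    rw [Finset.sum_mul_sum, mul_comm (∑ x ∈ configs n L (ext a'), _), Finset.sum_mul_sum,
      ← Finset.sum_sub_distrib]
    refine Finset.sum_congr rfl fun x _ => ?_
    rw [← Finset.sum_sub_distrib]
    exact Finset.sum_congr rfl fun x' _ => by ring
  have e2 : ∑ x ∈ configs n L (ext a), ∑ x' ∈ configs n L (ext a'), G x * G x' =
      (∑ x ∈ configs n L (ext a), G x) * ∑ x ∈ configs n L (ext a'), G x :=
    (Finset.sum_mul_sum _ _ _ _).symm
  rw [e1, e2] at hmain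
  have hmain' := hmain.trans (mul_le_mul_of_nonneg_right (sum_connections_le n L S hq0)
    (mul_nonneg (Finset.sum_nonneg fun x _ => hG x) (Finset.sum_nonneg fun x _ => hG x)))
  generalize (∑ x ∈ configs n L (ext a), (if x ∈ A then 1 else 0) * G x) = s1 at *
  generalize (∑ x ∈ configs n L (ext a'), (if x ∈ A then 1 else 0) * G x) = s1' at *
  generalize (∑ x ∈ configs n L (ext a), G x) = s2 at *
  generalize (∑ x ∈ configs n L (ext a'), G x) = s2' at *
  have e3 : c * s1 * (c * s2') - c * s1' * (c * s2) = (s1 * s2' - s1' * s2) * (c * c) := by ring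
  rw [e3, abs_mul, abs_of_nonneg (mul_nonneg hc0 hc0)]
  calc _ ≤ _ := mul_le_mul_of_nonneg_right hmain' (mul_nonneg hc0 hc0)
    _ = _ := by ring

/-! ### From boxes to the full observations -/

/-- Lévy's upward theorem in `L¹`, rewritten with Bochner integrals. -/
lemma tendsto_integral_abs_condExp_sub {Ω : Type*} [MeasurableSpace Ω] {P : Measure Ω}
    [IsFiniteMeasure P] (ℱ : Filtration ℕ ‹MeasurableSpace Ω›) (f : Ω → ℝ) :
    Tendsto (fun L => ∫ ω, |(P[f | ℱ L]) ω - (P[f | ⨆ L, ℱ L]) ω| ∂P) atTop (𝓝 0) := by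
  have h := (ENNReal.tendsto_toReal ENNReal.zero_ne_top).comp
    (tendsto_eLpNorm_condExp (μ := P) (ℱ := ℱ) f)
  refine h.congr fun L => ?_
  rw [Function.comp_apply, eLpNorm_one_eq_lintegral_enorm,
    ← integral_norm_eq_lintegral_enorm
      (integrable_condExp.sub integrable_condExp).aestronglyMeasurable]
  rfl

lemma integral_abs_condExp_iSup_sub_le {Ω : Type*} [MeasurableSpace Ω] {P : Measure Ω}
    [IsFiniteMeasure P] (ℱ 𝒢 : Filtration ℕ ‹MeasurableSpace Ω›) (f : Ω → ℝ) {ε : ℝ}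
    (h : ∀ᶠ L in atTop, ∫ ω, |(P[f | ℱ L]) ω - (P[f | 𝒢 L]) ω| ∂P ≤ ε) :
    ∫ ω, |(P[f | ⨆ L, ℱ L]) ω - (P[f | ⨆ L, 𝒢 L]) ω| ∂P ≤ ε := by
  have hlim := ((tendsto_integral_abs_condExp_sub (P := P) ℱ f).add
    (tendsto_integral_abs_condExp_sub (P := P) 𝒢 f)).add_const ε
  rw [add_zero, zero_add] at hlim
  refine ge_of_tendsto hlim (h.mono fun L hL => ?_)
  have hi (m m' : MeasurableSpace Ω) : Integrable (fun ω => |(P[f | m]) ω - (P[f | m']) ω|) P :=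
    (integrable_condExp.sub integrable_condExp).abs
  calc _ ≤ ∫ ω, (|(P[f | ℱ L]) ω - (P[f | ⨆ L, ℱ L]) ω| +
        |(P[f | 𝒢 L]) ω - (P[f | ⨆ L, 𝒢 L]) ω| + |(P[f | ℱ L]) ω - (P[f | 𝒢 L]) ω|) ∂P := by
        refine integral_mono (hi _ _) (((hi _ _).add (hi _ _)).add (hi _ _)) fun ω => ?_
        have h1 := abs_sub_le ((P[f | ⨆ L, ℱ L]) ω) ((P[f | ℱ L]) ω) ((P[f | ⨆ L, 𝒢 L]) ω)
        have h2 := abs_sub_le ((P[f | ℱ L]) ω) ((P[f | 𝒢 L]) ω) ((P[f | ⨆ L, 𝒢 L]) ω)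
        rw [abs_sub_comm ((P[f | ⨆ L, ℱ L]) ω) ((P[f | ℱ L]) ω)] at h1
        linarith
    _ = _ := by
        have e := integral_add ((hi (ℱ L) (⨆ L, ℱ L)).add (hi (𝒢 L) (⨆ L, 𝒢 L)))
          (hi (ℱ L) (𝒢 L))
        simp only [Pi.add_apply] at e
        rw [e, integral_add (hi _ _) (hi _ _)]
    _ ≤ _ := by gcongr

/-- Conditional probabilities of events that differ little are close in `L¹`. -/
lemma integral_abs_condExp_sub_condExp_le {Ω : Type*} (m : MeasurableSpace Ω) {m₀ : MeasurableSpace Ω}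
    {P : Measure Ω} [IsProbabilityMeasure P] {A A' : Set Ω} (hA : MeasurableSet A)
    (hA' : MeasurableSet A') :
    ∫ ω, |(P⟦A | m⟧) ω - (P⟦A' | m⟧) ω| ∂P ≤ P.real (symmDiff A A') := by
  have hi {s : Set Ω} (hs : MeasurableSet s) : Integrable (s.indicator fun _ => (1 : ℝ)) P :=
    (integrable_const 1).indicator hs
  calc _ = ∫ ω, |(P[(A.indicator fun _ => (1 : ℝ)) - A'.indicator fun _ => (1 : ℝ) | m]) ω| ∂P := by
        refine integral_congr_ae ?_
        filter_upwards [condExp_sub (hi hA) (hi hA') m] with ω hω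
        rw [hω]; rfl
    _ ≤ ∫ ω, |((A.indicator fun _ => (1 : ℝ)) - A'.indicator fun _ => (1 : ℝ)) ω| ∂P :=
        integral_abs_condExp_le _
    _ = ∫ ω, (symmDiff A A').indicator (fun _ => (1 : ℝ)) ω ∂P := by
        congr 1
        ext ω
        by_cases h : ω ∈ A <;> by_cases h' : ω ∈ A' <;> simp [Set.mem_symmDiff, h, h']
    _ = P.real (symmDiff A A') := by
        rw [integral_indicator_const _ (hA.symmDiff hA'), smul_eq_mul, mul_one]

/-- The data in growing boxes generate the initial state and the observations. -/
def dataFiltration (n : ℕ) : Filtration ℕ (inferInstance : MeasurableSpace Sample) where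
  seq L := MeasurableSpace.comap (fun ω => (dataX L ω, dataY n L ω)) inferInstance
  mono' L L' hLL := by
    refine measurable_iff_comap_le.1 ?_
    have hX : Finset.Icc (-L : ℤ) (L + 1) ⊆ Finset.Icc (-L' : ℤ) (L' + 1) :=
      Finset.Icc_subset_Icc (by omega) (by omega)
    have hY : box n L ⊆ box n L' := fun e he => by rw [mem_box] at he ⊢; omega
    exact (Measurable.of_discrete (f := fun d : (Finset.Icc (-L' : ℤ) (L' + 1) → ℤˣ) ×
      (box n L' → ℤˣ) => ((fun v : Finset.Icc (-L : ℤ) (L + 1) => d.1 ⟨v, hX v.2⟩),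
        fun e : box n L => d.2 ⟨e, hY e.2⟩))).comp
      (comap_measurable fun ω => (dataX L' ω, dataY n L' ω))
  le' L := (measurable_data n L).comap_le.trans (initObsSigma_le n)

/-- The observations in growing boxes. -/
def obsFiltration (n : ℕ) : Filtration ℕ (inferInstance : MeasurableSpace Sample) where
  seq L := MeasurableSpace.comap (dataY n L) inferInstance
  mono' L L' hLL := by
    refine measurable_iff_comap_le.1 ?_
    have hY : box n L ⊆ box n L' := fun e he => by rw [mem_box] at he ⊢; omega
    exact (Measurable.of_discrete (f := fun d : box n L' → ℤˣ =>
      fun e : box n L => d ⟨e, hY e.2⟩)).comp (comap_measurable (dataY n L'))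
  le' L := (measurable_dataY n L).comap_le.trans (obsSigma_le n)

lemma obsSigma_le_of_measurable {n : ℕ} {m : MeasurableSpace Sample}
    (h : ∀ L, ∀ e ∈ box n L, Measurable[m] (obs e)) : obsSigma Y n ≤ m := by
  refine iSup₂_le fun j hj => ?_
  refine measurable_iff_comap_le.1 (@measurable_pi_lambda Sample _ (fun _ => _) (m)
    (fun _ => _) _ fun v => ?_)
  have hmem (b : Bool) : (b, j, v) ∈ box n v.natAbs :=
    mem_box.2 ⟨hj, by simp only; omega, by simp only; omega⟩
  exact (h _ _ (hmem true)).prodMk (h _ _ (hmem false))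

lemma iSup_obsFiltration (n : ℕ) : ⨆ L, obsFiltration n L = obsSigma Y n := by
  refine le_antisymm (iSup_le fun L => (measurable_dataY n L).comap_le) ?_
  refine obsSigma_le_of_measurable fun L e he => ?_
  exact ((measurable_pi_apply (⟨e, he⟩ : box n L)).comp
    (comap_measurable (dataY n L))).mono (le_iSup (fun L => obsFiltration n L) L) le_rfl

lemma iSup_dataFiltration (n : ℕ) : ⨆ L, dataFiltration n L = initObsSigma X Y n := by
  refine le_antisymm (iSup_le fun L => (measurable_data n L).comap_le) (sup_le ?_ ?_)
  · refine measurable_iff_comap_le.1 (@measurable_pi_lambda Sample _ (fun _ => _) (_)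
      (fun _ => _) _ fun v => ?_)
    have hv : v ∈ Finset.Icc (-(v.natAbs : ℤ)) (v.natAbs + 1) :=
      Finset.mem_Icc.2 ⟨by omega, by omega⟩
    exact ((measurable_pi_apply (⟨v, hv⟩ : Finset.Icc (-(v.natAbs : ℤ)) (v.natAbs + 1))).comp
      (measurable_fst.comp (comap_measurable fun ω =>
        (dataX v.natAbs ω, dataY n v.natAbs ω)))).mono
        (le_iSup (fun L => dataFiltration n L) v.natAbs) le_rfl
  · refine obsSigma_le_of_measurable fun L e he => ?_
    exact ((measurable_pi_apply (⟨e, he⟩ : box n L)).comp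
      (measurable_snd.comp (comap_measurable fun ω => (dataX L ω, dataY n L ω)))).mono
        (le_iSup (fun L => dataFiltration n L) L) le_rfl

/-! ### From cylinder events to filter stability -/

/-- The law of the state does not depend on time. -/
lemma map_X (p : unitInterval) (k : ℤ) : (law p).map (X k) =
    Measure.infinitePi fun _ : ℤ => bernoulliMeasure (-1) 1 half := by
  have h := (iIndepFun_coord p).precomp (g := fun v : ℤ => (.inl (k, v) : Coord))
    fun v w h => by simpa using h
  rw [iIndepFun_iff_map_fun_eq_infinitePi_map fun v => measurable_coord _] at h
  have hm (v : ℤ) : (law p).map (coord (.inl (k, v))) = bernoulliMeasure (-1) 1 half := by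
    ext t ht
    rw [Measure.map_apply (measurable_coord _) ht, law_coord_preimage]
    rfl
  simp_rw [hm] at h
  exact h

/-- The bound in a box does not depend on `L` once the box covers `S`, so it survives the limit. -/
lemma integral_abs_condExp_cylinder_le {p : unitInterval} (hp : (p : ℝ) ≤ 1 / 2) {n : ℕ}
    (hn : 1 ≤ n) (S : Finset ℤ) (S₀ : Set (S → ℤˣ)) :
    ∫ ω, |((law p)⟦X n ⁻¹' cylinder S S₀ | initObsSigma X Y n⟧) ω -
      ((law p)⟦X n ⁻¹' cylinder S S₀ | obsSigma Y n⟧) ω| ∂law p ≤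
      S.card * 18 * (18 * (1 - ((p : ℝ) / (1 - p)) ^ 2)) ^ n := by
  rw [← iSup_dataFiltration, ← iSup_obsFiltration]
  refine integral_abs_condExp_iSup_sub_le _ _ _ ?_
  obtain ⟨M, hM⟩ : ∃ M : ℕ, ∀ v ∈ S, v.natAbs ≤ M :=
    ⟨S.sup Int.natAbs, fun v hv => Finset.le_sup (f := Int.natAbs) hv⟩
  filter_upwards [eventually_ge_atTop M] with L hL
  refine integral_abs_condExp_box_le hp hn (fun v hv => Finset.mem_Icc.2 ?_) S₀
  have := hM v hv
  constructor <;> omega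

theorem filterStable {p : unitInterval} (hp : 499 / 1000 < (p : ℝ)) (hp' : (p : ℝ) ≤ 1 / 2) :
    FilterStable (law p) X Y := by
  intro A hA
  set r : ℝ := 18 * (1 - ((p : ℝ) / (1 - p)) ^ 2) with hr
  -- From `p / (1 - p) ≥ 499 / 501` it follows that `r ≤ 36000 / 251001`.
  have hr1 : |r| < 1 := by
    have h1 : 499 / 501 ≤ (p : ℝ) / (1 - p) := by
      rw [div_le_div_iff₀ (by norm_num) (by linarith)]; linarith
    have h2 : (p : ℝ) / (1 - p) ≤ 1 := by rw [div_le_one (by linarith)]; linarith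
    rw [abs_lt, hr]
    constructor <;> nlinarith
  rw [Metric.tendsto_atTop]
  intro ε hε
  -- The law of `X n` is the same for all `n`, so a single approximating cylinder serves all times.
  have hdense := Measure.MeasureDense.of_generateFrom_isSetAlgebra_finite
    (Measure.infinitePi fun _ : ℤ => (bernoulliMeasure (-1) 1 half : Measure ℤˣ))
    isSetAlgebra_measurableCylinders generateFrom_measurableCylinders.symm
  obtain ⟨A', hA', hAA'⟩ := hdense.approx A hA (measure_ne_top _ _) (ε / 4) (by positivity)
  obtain ⟨S, S₀, hS₀, rfl⟩ := (mem_measurableCylinders A').1 hA'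
  have hlim : Tendsto (fun n : ℕ => (S.card : ℝ) * 18 * r ^ n) atTop (𝓝 0) := by
    simpa using (tendsto_pow_atTop_nhds_zero_of_abs_lt_one hr1).const_mul ((S.card : ℝ) * 18)
  obtain ⟨N, hN⟩ := (hlim.eventually_lt_const (by positivity : 0 < ε / 4)).exists_forall_of_atTop
  refine ⟨max N 1, fun n hn => ?_⟩
  have hcyl : MeasurableSet (cylinder (α := fun _ : ℤ => ℤˣ) S S₀) := MeasurableSet.cylinder S hS₀
  have hdiff : (law p).real (symmDiff (X n ⁻¹' A) (X n ⁻¹' cylinder S S₀)) ≤ ε / 4 := by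
    rw [← Set.preimage_symmDiff, measureReal_def,
      ← Measure.map_apply (measurable_X n) (hA.symmDiff hcyl), map_X]
    exact ENNReal.toReal_le_of_le_ofReal (by positivity) hAA'.le
  have hclose (m : MeasurableSpace Sample) := (integral_abs_condExp_sub_condExp_le m (P := law p)
    (measurable_X n hA) (measurable_X n hcyl)).trans hdiff
  have hcyl_le := integral_abs_condExp_cylinder_le hp' ((le_max_right N 1).trans hn) S S₀
  have hNn := hN n ((le_max_left N 1).trans hn)
  have hi (s s' : Set Sample) (m m' : MeasurableSpace Sample) :
      Integrable (fun ω => |((law p)⟦s | m⟧) ω - ((law p)⟦s' | m'⟧) ω|) (law p) :=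
    (integrable_condExp.sub integrable_condExp).abs
  rw [Real.dist_eq, sub_zero, abs_of_nonneg (integral_nonneg fun _ => abs_nonneg _)]
  set H := initObsSigma X Y n
  set G := obsSigma Y n
  set B := X n ⁻¹' A
  set B' := X n ⁻¹' cylinder S S₀
  calc ∫ ω, |((law p)⟦B | H⟧) ω - ((law p)⟦B | G⟧) ω| ∂law p
      ≤ ∫ ω, (|((law p)⟦B | H⟧) ω - ((law p)⟦B' | H⟧) ω| +
          |((law p)⟦B | G⟧) ω - ((law p)⟦B' | G⟧) ω| +
          |((law p)⟦B' | H⟧) ω - ((law p)⟦B' | G⟧) ω|) ∂law p := by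
        refine integral_mono (hi _ _ _ _) (((hi _ _ _ _).add (hi _ _ _ _)).add (hi _ _ _ _))
          fun ω => ?_
        have h1 := abs_sub_le (((law p)⟦B | H⟧) ω) (((law p)⟦B' | H⟧) ω) (((law p)⟦B | G⟧) ω)
        have h2 := abs_sub_le (((law p)⟦B' | H⟧) ω) (((law p)⟦B' | G⟧) ω) (((law p)⟦B | G⟧) ω)
        rw [abs_sub_comm (((law p)⟦B' | G⟧) ω)] at h2
        simp only
        linarith
    _ = ∫ ω, |((law p)⟦B | H⟧) ω - ((law p)⟦B' | H⟧) ω| ∂law p +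
          ∫ ω, |((law p)⟦B | G⟧) ω - ((law p)⟦B' | G⟧) ω| ∂law p +
          ∫ ω, |((law p)⟦B' | H⟧) ω - ((law p)⟦B' | G⟧) ω| ∂law p := by
        have e := integral_add ((hi B B' H H).add (hi B B' G G)) (hi B' B' H G)
        simp only [Pi.add_apply] at e
        rw [e, integral_add (hi _ _ _ _) (hi _ _ _ _)]
    _ < ε := by linarith [hclose H, hclose G]

end SpinModel

end

theorem mainTheorem1 :
    (∃ pLow pHigh : ℝ, 0 < pLow ∧ pLow ≤ pHigh ∧ pHigh < 1 / 2 ∧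
      ∀ p : unitInterval,
        (pHigh < (p : ℝ) ∧ (p : ℝ) ≤ 1 / 2 →
          FilterStable (SpinModel.law p) SpinModel.X SpinModel.Y) ∧
        ((p : ℝ) < pLow →
          ¬ FilterStable (SpinModel.law p) SpinModel.X SpinModel.Y)) ∧
    (∀ p : unitInterval, OneDependent (SpinModel.law p) SpinModel.field) :=
  ⟨⟨1 / 32400, 499 / 1000, by norm_num, by norm_num, by norm_num, fun _ =>
    ⟨fun h => SpinModel.filterStable h.1 h.2, SpinModel.not_filterStable⟩⟩,
    SpinModel.oneDependent_field⟩
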